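/- \textbf{Setup.} Let $\mathcal G$ be a finite nonempty set of groups. Each $G\in\mathcal G$ has a reservoir distribution, a probability measure on $\mathbb R$ with CDF $F_G$ and quantile function $F_G^{-1}(p)=\inf\{\tau: F_G(\tau)\ge p\}$. Requesting an arm from $G$ draws its (unobserved) mean $\mu$ from $F_G$; successive pulls of an arm with mean $\mu$ then give i.i.d. rewards with law $\nu_\mu$, where $(\nu_\mu)$ is one common (measurable) family of distributions parametrized by the mean. Different arms are independent. Assume that every arm mean lies in $[0,1]$, and that for every arm mean $\mu$ the law $\nu_\mu$ has mean $\mu$ and is sub-Gaussian with some parameter $\sigma^2\le 1$: $\mathbb E[e^{\lambda(X-\mu)}]\le e^{\lambda^2\sigma^2/2}$ for all $\lambda\in\mathbb R$. \textbf{Parameters.} $\alpha,\epsilon,\Delta,\delta\in(0,1)$ with $\delta<\epsilon<\min(\alpha,1-\alpha)$. \textbf{Algorithm.} Request $N=\big\lceil\frac{1}{2\epsilon^2}\log\frac{2|\mathcal G|}{\delta}\big\rceil$ arms from each $G\in\mathcal G$, and let $n=N|\mathcal G|$. Write $j\in G$ if arm $j$ was requested from $G$. For real numbers $(x_j)_{j\in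 G}$ let $Q(x)=\inf\{\tau : \frac1N\#\{j\in G: x_j\le\tau\}\ge 1-\alpha\}$. Let $$U(T,\eta)=\sqrt{\frac{2\log(1/\eta)+6\log\log(1/\eta)+3\log\log(eT)}{T}}.$$ Set $t=1$, $C_1=\mathcal G$, $B_1=$ the set of all $n$ requested arms, $\Delta^{(1)}=\infty$. While $|C_t|>1$ and $\Delta^{(t)}>\Delta$: \begin{itemize} \item pull every arm in $B_t$ once; let $T_j(t)$ be the total number of pulls of arm $j$ so far, $\hat\mu_j(t)$ the mean of the rewards observed from it, $\mathrm{LCB}_t(j)=\hat\mu_j(t)-U(T_j(t),\delta/n)$ and $\mathrm{UCB}_t(j)=\hat\mu_j(t)+U(T_j(t),\delta/n)$; for a group $G$ let $L_t(G)=Q((\mathrm{LCB}_t(j))_{j\in G})$ and $V_t(G)=Q((\mathrm{UCB}_t(j))_{j\in G})$; \item let $C_{t+1}=\{G\in C_t: V_t(G)\ge L_t(G')\ \text{for all } G'\in C_t\}$; \item let $B_{t+1}$ be the set of arms $j$ that belong to some group $G\in C_{t+1}$ and satisfy $\mathrm{LCB}_t(j)\le V_t(G)$ and $\mathrm{UCB}_t(j)\ge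 L_t(G)$; \item let $\Delta^{(t+1)}=\max_{G\in C_{t+1}}V_t(G)-\max_{G\in C_{t+1}}L_t(G)$, and increase $t$ by $1$. \end{itemize} When the loop ends, return a group $\widehat G$ chosen uniformly at random (independently of the arms and rewards) among the maximizers of $L_{t-1}$ over $C_t$ (if the loop never runs, $|\mathcal G|=1$ and the only group is returned). \textbf{Theorem.} With probability at least $1-2\delta$, the algorithm terminates and returns a group $\widehat G\in\mathcal G$ with $$F_{\widehat G}^{-1}(1-\alpha+\epsilon)\ \ge\ \max_{G'\in\mathcal G}F_{G'}^{-1}(1-\alpha-\epsilon)-\Delta .$$ -/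

import Mathlib

open MeasureTheory ProbabilityTheory
open scoped NNReal

noncomputable section

namespace GroupedBandit

/-! ### Quantiles -/

/-- The quantile function `F⁻¹(p) = inf {τ : F(τ) ≥ p}` of a probability measure on `ℝ`
with distribution function `F`. -/
def quantile (ρ : Measure ℝ) (p : ℝ) : ℝ :=
  sInf {τ : ℝ | p ≤ cdf ρ τ}

/-- The `p`-quantile `inf {τ : #{i : x i ≤ τ} / N ≥ p}` of the multiset `x 0, …, x (N - 1)`. -/
def finQuantile {N : ℕ} (p : ℝ) (x : Fin N → ℝ) : ℝ :=
  sInf {τ : ℝ | p ≤ ((Finset.univ.filter fun i => x i ≤ τ).card : ℝ) / N}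

/-! ### Confidence bounds

Arm `j = (g, i)` is the `i`-th arm requested from group `g`, and `X j s` is the reward
observed at the `(s + 1)`-st pull of arm `j`. -/

/-- The width
`U(T, δ) = √((2 log (1/δ) + 6 log log (1/δ) + 3 log log (e T)) / T)`. -/
def confWidth (T : ℕ) (δ : ℝ) : ℝ :=
  Real.sqrt ((2 * Real.log (1 / δ) + 6 * Real.log (Real.log (1 / δ))
    + 3 * Real.log (Real.log (Real.exp 1 * T))) / T)

/-- The empirical mean of the first `T` observed rewards of an arm. -/
def empMean (x : ℕ → ℝ) (T : ℕ) : ℝ :=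
  (∑ s ∈ Finset.range T, x s) / T

section FiniteArm

variable {𝒢 : Type*} [Fintype 𝒢] {N : ℕ}

/-- Lower confidence bound of arm `j` after `T j` pulls; the total number of arms is
`n = N * |𝒢|`. -/
def lcb (δ : ℝ) (X : 𝒢 × Fin N → ℕ → ℝ) (T : 𝒢 × Fin N → ℕ) (j : 𝒢 × Fin N) : ℝ :=
  empMean (X j) (T j) - confWidth (T j) (δ / ((N * Fintype.card 𝒢 : ℕ) : ℝ))

/-- Upper confidence bound of arm `j` after `T j` pulls. -/
def ucb (δ : ℝ) (X : 𝒢 × Fin N → ℕ → ℝ) (T : 𝒢 × Fin N → ℕ) (j : 𝒢 × Fin N) : ℝ :=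
  empMean (X j) (T j) + confWidth (T j) (δ / ((N * Fintype.card 𝒢 : ℕ) : ℝ))

/-- The `(1 - α)`-quantile of the lower confidence bounds of the arms of group `g`. -/
def lcbQuantile (α δ : ℝ) (X : 𝒢 × Fin N → ℕ → ℝ) (T : 𝒢 × Fin N → ℕ) (g : 𝒢) : ℝ :=
  finQuantile (1 - α) fun i => lcb δ X T (g, i)

/-- The `(1 - α)`-quantile of the upper confidence bounds of the arms of group `g`. -/
def ucbQuantile (α δ : ℝ) (X : 𝒢 × Fin N → ℕ → ℝ) (T : 𝒢 × Fin N → ℕ) (g : 𝒢) : ℝ :=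
  finQuantile (1 - α) fun i => ucb δ X T (g, i)

/-! ### The finite-arm elimination subroutine -/

/-- What the elimination algorithm stores at the beginning of round `t`. -/
structure ElimState (𝒢 : Type*) (N : ℕ) where
  /-- `T_j(t - 1)`, the number of pulls of each arm so far -/
  pulls : 𝒢 × Fin N → ℕ
  /-- `C_t`, the candidate groups -/
  candidates : Finset 𝒢
  /-- `B_t`, the active arms -/
  active : Finset (𝒢 × Fin N)
  /-- `Δ^(t)` -/
  gap : EReal

/-- The state at the beginning of round `1`. -/
def ElimState.init : ElimState 𝒢 N where
  pulls := fun _ => 0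
  candidates := Finset.univ
  active := Finset.univ
  gap := ⊤

open scoped Classical in
/-- One round of the loop: pull every active arm once, then update the candidate groups, the
active arms (the potential `(1 - α)`-quantile arms of the candidate groups) and the gap. -/
def ElimState.step (α δ : ℝ) (X : 𝒢 × Fin N → ℕ → ℝ) (s : ElimState 𝒢 N) : ElimState 𝒢 N :=
  let T : 𝒢 × Fin N → ℕ := fun j => s.pulls j + if j ∈ s.active then 1 else 0
  let C : Finset 𝒢 := s.candidates.filter fun g =>
    ∀ g' ∈ s.candidates, lcbQuantile α δ X T g' ≤ ucbQuantile α δ X T g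
  { pulls := T
    candidates := C
    active := Finset.univ.filter fun j =>
      j.1 ∈ C ∧ lcb δ X T j ≤ ucbQuantile α δ X T j.1 ∧ lcbQuantile α δ X T j.1 ≤ ucb δ X T j
    gap := ((sSup (ucbQuantile α δ X T '' (C : Set 𝒢))
      - sSup (lcbQuantile α δ X T '' (C : Set 𝒢)) : ℝ) : EReal) }

/-- The loop runs while there is more than one candidate group and the gap exceeds `Δ`. -/
def ElimState.Halted (Δ : ℝ) (s : ElimState 𝒢 N) : Prop :=
  ¬ (1 < s.candidates.card ∧ (Δ : EReal) < s.gap)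

/-- The state after `k` rounds, that is, at the beginning of round `k + 1`. -/
def elimState (α δ : ℝ) (X : 𝒢 × Fin N → ℕ → ℝ) (k : ℕ) : ElimState 𝒢 N :=
  (ElimState.step α δ X)^[k] ElimState.init

open scoped Classical in
/-- The candidate groups whose lower confidence bounds have the largest `(1 - α)`-quantile. -/
def ElimState.best (α δ : ℝ) (X : 𝒢 × Fin N → ℕ → ℝ) (s : ElimState 𝒢 N) : Finset 𝒢 :=
  s.candidates.filter fun g =>
    ∀ g' ∈ s.candidates, lcbQuantile α δ X s.pulls g' ≤ lcbQuantile α δ X s.pulls g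

open scoped Classical in
/-- The group returned by the elimination algorithm on the reward table `X`: the state is read
off when the loop condition fails for the first time, and `tie S` is the outcome of a tie-break
among the groups in `S`. The value is `none` if the loop never terminates. -/
def finiteArmBQID (α Δ δ : ℝ) (X : 𝒢 × Fin N → ℕ → ℝ) (tie : Finset 𝒢 → 𝒢) : Option 𝒢 :=
  if h : ∃ k, (elimState α δ X k).Halted Δ then
    some (tie ((elimState α δ X (Nat.find h)).best α δ X))
  else none

end FiniteArm

/-! ### The random environment -/

/-- The law of an i.i.d. sequence of rewards, as a function of the mean `m` of the arm: each
reward has law `ν m`. -/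
def rewardSeq (ν : Kernel ℝ ℝ) [IsMarkovKernel ν] : Kernel ℝ (ℕ → ℝ) where
  toFun m := Measure.infinitePi fun _ : ℕ => ν m
  measurable' := by
    refine Measurable.measure_of_isPiSystem_of_isProbabilityMeasure
      generateFrom_squareCylinders.symm
      (isPiSystem_squareCylinders (fun _ => MeasurableSpace.isPiSystem_measurableSet) (by simp)) ?_
    rintro S ⟨s, t, ht, rfl⟩
    have ht' : ∀ i, MeasurableSet (t i) := fun i => ht i (Set.mem_univ i)
    simp_rw [Measure.infinitePi_pi _ (fun i _ => ht' i)]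
    exact Finset.measurable_prod _ fun i _ => ν.measurable_coe (ht' i)

instance rewardSeq_isMarkov (ν : Kernel ℝ ℝ) [IsMarkovKernel ν] : IsMarkovKernel (rewardSeq ν) :=
  ⟨fun m => inferInstanceAs (IsProbabilityMeasure (Measure.infinitePi fun _ : ℕ => ν m))⟩

/-- The joint law of the mean and of the reward sequence of an arm requested from a group with
reservoir distribution `ρ`: the mean is drawn from `ρ`, and given the mean `m` the rewards are
i.i.d. with law `ν m`. -/
def armLaw (ρ : Measure ℝ) (ν : Kernel ℝ ℝ) [IsMarkovKernel ν] : Measure (ℝ × (ℕ → ℝ)) :=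
  ρ ⊗ₘ rewardSeq ν

/-- The assumption on the arms. The reward distributions form one family `ν`, parametrized by
the mean; for (almost) every arm mean `m` of every group, `m` lies in `[0, 1]`, the distribution
`ν m` has mean `m`, and it is sub-Gaussian with some parameter `σ² ≤ 1`. -/
def RewardAssumption {𝒢 : Type*} (ρ : 𝒢 → Measure ℝ) (ν : Kernel ℝ ℝ) : Prop :=
  ∀ g, ∀ᵐ m ∂(ρ g), m ∈ Set.Icc (0 : ℝ) 1 ∧ ∫ x, x ∂(ν m) = m ∧
    ∃ σsq : ℝ≥0, σsq ≤ 1 ∧ HasSubgaussianMGF (fun x => x - m) σsq (ν m)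

/-- The random quantities that drive a run: the mean `M j` and the successive rewards `X j` of
every requested arm `j`, independent between arms, and, independent of these, a uniformly random
choice `tie S` from every nonempty set `S` of groups. -/
structure IsEnvironment {Ω 𝒢 : Type*} [MeasurableSpace Ω] [MeasurableSpace 𝒢] {N : ℕ}
    (P : Measure Ω) (ρ : 𝒢 → Measure ℝ) (ν : Kernel ℝ ℝ) [IsMarkovKernel ν]
    (M : 𝒢 × Fin N → Ω → ℝ) (X : 𝒢 × Fin N → ℕ → Ω → ℝ) (tie : Finset 𝒢 → Ω → 𝒢) : Prop where
  measurable_mean : ∀ j, Measurable (M j)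
  measurable_reward : ∀ j s, Measurable (X j s)
  measurable_tie : ∀ S, Measurable (tie S)
  arm_law : ∀ j, P.map (fun ω => (M j ω, fun s => X j s ω)) = armLaw (ρ j.1) ν
  arm_indep : iIndepFun (fun j ω => (M j ω, fun s => X j s ω)) P
  tie_law : ∀ S : Finset 𝒢, S.Nonempty → P.map (tie S) = uniformOn (S : Set 𝒢)
  tie_indep : IndepFun (fun ω S => tie S ω) (fun ω j => (M j ω, fun s => X j s ω)) P

/-! ### The two-step algorithm -/

/-- The number `N = ⌈(1 / (2 ε²)) log (2 |𝒢| / δ)⌉` of arms requested from each of the `G`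
groups. -/
def numArms (ε δ : ℝ) (G : ℕ) : ℕ :=
  ⌈1 / (2 * ε ^ 2) * Real.log (2 * G / δ)⌉₊

end GroupedBandit

end

noncomputable section

namespace GroupedBandit

open Filter Topology

/-! ### Empirical quantiles -/

section FinQuantile

variable {N : ℕ} {p : ℝ}

/-! The argument intersects two events, each failing with probability at most δ. On the first, every
empirical mean stays within `confWidth` of its arm mean at all times. On the second, the empirical
(1 - α)-quantile of the arm means of each group lies between the reservoir quantiles at 1 - α - ε
and 1 - α + ε.

The algorithm itself is analysed deterministically. Empirical quantiles are monotone, so on the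
first event L(G) ≤ Q(μ_G) ≤ V(G) in every round. A group maximizing Q(μ_G) is therefore never
eliminated, and a gap of at most Δ at the stop makes the returned group Δ-optimal for Q
(`finiteArmBQID_correct`). Termination holds on every reward table: V(G) - L(G) is at most twice the
largest width of an active arm of G, and active arms keep being pulled (`exists_halted`).

The second event is Hoeffding's inequality for the number of arm means below or above a reservoir
quantile. The first is a finite-time law of the iterated logarithm with explicit constants
(`measure_exists_mul_confWidth_lt_sum`). Ville's inequality for exponential martingales bounds the
crossing of a line. The boundary, roughly √(T log log T), dominates one such line on each of a
geometric sequence of epochs, and the crossing probabilities are summable. -/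

lemma card_filter_le_mono (x : Fin N → ℝ) {σ τ : ℝ} (h : σ ≤ τ) :
    ((Finset.univ.filter fun i => x i ≤ σ).card : ℝ) / N
      ≤ ((Finset.univ.filter fun i => x i ≤ τ).card : ℝ) / N := by
  gcongr

/-- The empirical distribution function jumps only at sample points, so the smallest sample point in
the set is its minimum. Positivity of `p` forces a sample point below each member; `p ≤ 1` puts the
largest sample in the set. -/
lemma finQuantile_isLeast (hN : 0 < N) (hp0 : 0 < p) (hp1 : p ≤ 1) (x : Fin N → ℝ) :
    IsLeast {τ : ℝ | p ≤ ((Finset.univ.filter fun i => x i ≤ τ).card : ℝ) / N}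
      (finQuantile p x) := by
  classical
  set S := {τ : ℝ | p ≤ ((Finset.univ.filter fun i => x i ≤ τ).card : ℝ) / N} with hS
  have key : ∀ τ ∈ S, ∃ i, x i ∈ S ∧ x i ≤ τ := by
    intro τ hτ
    have hne : (Finset.univ.filter fun i => x i ≤ τ).Nonempty := by
      rw [← Finset.card_pos, Nat.pos_iff_ne_zero]
      intro h0
      simp only [hS, Set.mem_ofPred_eq, h0, Nat.cast_zero, zero_div] at hτ
      linarith
    obtain ⟨i, hi, hmax⟩ := Finset.exists_max_image _ x hne
    refine ⟨i, le_trans (show p ≤ _ from hτ) ?_, (Finset.mem_filter.1 hi).2⟩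
    have : (Finset.univ.filter fun k => x k ≤ τ) ⊆ Finset.univ.filter fun k => x k ≤ x i :=
      fun k hk => Finset.mem_filter.2 ⟨Finset.mem_univ _, hmax k hk⟩
    gcongr
  have hSne : S.Nonempty := by
    have : Nonempty (Fin N) := ⟨⟨0, hN⟩⟩
    refine ⟨Finset.univ.sup' Finset.univ_nonempty x, ?_⟩
    have hall : (Finset.univ.filter fun i => x i ≤ Finset.univ.sup' Finset.univ_nonempty x)
        = Finset.univ :=
      Finset.filter_true_of_mem fun i _ => Finset.le_sup' x (Finset.mem_univ i)
    have hN' : (N : ℝ) ≠ 0 := by positivity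
    simpa only [hS, Set.mem_ofPred_eq, hall, Finset.card_univ, Fintype.card_fin, div_self hN']
  obtain ⟨τ₀, hτ₀⟩ := hSne
  obtain ⟨i₀, hi₀, -⟩ := key τ₀ hτ₀
  obtain ⟨i, hi, hmin⟩ := Finset.exists_min_image (Finset.univ.filter fun i => x i ∈ S) x
    ⟨i₀, by simpa using hi₀⟩
  have hleast : IsLeast S (x i) := by
    refine ⟨(Finset.mem_filter.1 hi).2, fun τ hτ => ?_⟩
    obtain ⟨k, hk, hkτ⟩ := key τ hτ
    exact (hmin k (by simpa using hk)).trans hkτ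
  have : finQuantile p x = x i := hleast.csInf_eq
  rwa [this]

lemma finQuantile_le_iff (hN : 0 < N) (hp0 : 0 < p) (hp1 : p ≤ 1) (x : Fin N → ℝ) (τ : ℝ) :
    finQuantile p x ≤ τ ↔ p ≤ ((Finset.univ.filter fun i => x i ≤ τ).card : ℝ) / N := by
  have h := finQuantile_isLeast hN hp0 hp1 x
  exact ⟨fun hle => le_trans (show p ≤ _ from h.1) (card_filter_le_mono x hle), fun hp => h.2 hp⟩

lemma finQuantile_mono (hN : 0 < N) (hp0 : 0 < p) (hp1 : p ≤ 1) {x y : Fin N → ℝ}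
    (h : ∀ i, x i ≤ y i) : finQuantile p x ≤ finQuantile p y := by
  rw [finQuantile_le_iff hN hp0 hp1]
  refine le_trans (finQuantile_isLeast hN hp0 hp1 y).1 ?_
  gcongr with i
  exact h i

end FinQuantile

/-! ### The confidence width -/

lemma confWidth_nonneg (T : ℕ) (δ : ℝ) : 0 ≤ confWidth T δ := Real.sqrt_nonneg _

lemma tendsto_confWidth (δ : ℝ) : Tendsto (fun T : ℕ => confWidth T δ) atTop (𝓝 0) := by
  set c := 2 * Real.log (1 / δ) + 6 * Real.log (Real.log (1 / δ)) with hc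
  have hlog : Tendsto (fun T : ℕ => Real.log T / T) atTop (𝓝 0) := by
    have := Real.isLittleO_log_id_atTop.tendsto_div_nhds_zero
    exact this.comp tendsto_natCast_atTop_atTop
  have hconst : Tendsto (fun T : ℕ => c / (T : ℝ)) atTop (𝓝 0) :=
    tendsto_const_div_atTop_nhds_zero_nat c
  have hloglog : Tendsto (fun T : ℕ => Real.log (Real.log (Real.exp 1 * T)) / T) atTop (𝓝 0) := by
    -- Squeeze by 0 ≤ log (1 + log T) ≤ log T for T ≥ 1.
    refine tendsto_of_tendsto_of_tendsto_of_le_of_le' tendsto_const_nhds hlog ?_ ?_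
    all_goals
      filter_upwards [eventually_ge_atTop 1] with T hT
      have hT' : (1 : ℝ) ≤ T := by exact_mod_cast hT
      have h1 : Real.log (Real.exp 1 * T) = 1 + Real.log T := by
        rw [Real.log_mul (Real.exp_ne_zero _) (by positivity), Real.log_exp]
      have h2 := Real.log_nonneg hT'
      rw [h1]
    · exact div_nonneg (Real.log_nonneg (by linarith)) (by positivity)
    · refine div_le_div_of_nonneg_right ?_ (by positivity)
      have := Real.log_le_sub_one_of_pos (show 0 < 1 + Real.log T by linarith)
      linarith
  have : Tendsto (fun T : ℕ => c / (T : ℝ)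
      + 3 * (Real.log (Real.log (Real.exp 1 * T)) / T)) atTop (𝓝 (0 + 3 * 0)) :=
    hconst.add (hloglog.const_mul 3)
  have h := (Real.continuous_sqrt.tendsto _).comp this
  simp only [mul_zero, add_zero, Real.sqrt_zero] at h
  refine h.congr fun T => ?_
  simp only [Function.comp_apply, confWidth, hc]
  congr 1
  ring

/-! ### The elimination subroutine -/

section Elimination

variable {𝒢 : Type*} [Fintype 𝒢] {N : ℕ} {α δ : ℝ} {X : 𝒢 × Fin N → ℕ → ℝ}

lemma ucb_eq_lcb_add (T : 𝒢 × Fin N → ℕ) (j : 𝒢 × Fin N) :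
    ucb δ X T j = lcb δ X T j + 2 * confWidth (T j) (δ / ((N * Fintype.card 𝒢 : ℕ) : ℝ)) := by
  unfold ucb lcb
  ring

lemma lcb_le_ucb (T : 𝒢 × Fin N → ℕ) (j : 𝒢 × Fin N) : lcb δ X T j ≤ ucb δ X T j := by
  rw [ucb_eq_lcb_add]
  linarith [confWidth_nonneg (T j) (δ / ((N * Fintype.card 𝒢 : ℕ) : ℝ))]

lemma lcbQuantile_le_ucbQuantile (hN : 0 < N) (hα : α ∈ Set.Ioo (0 : ℝ) 1)
    (T : 𝒢 × Fin N → ℕ) (g : 𝒢) : lcbQuantile α δ X T g ≤ ucbQuantile α δ X T g :=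
  finQuantile_mono hN (by linarith [hα.2]) (by linarith [hα.1]) fun _ => lcb_le_ucb T _

/-- The two quantiles of a group differ by at most twice the largest width of its potential
quantile arms. -/
lemma ucbQuantile_le_lcbQuantile_add (hN : 0 < N) (hα : α ∈ Set.Ioo (0 : ℝ) 1)
    {T : 𝒢 × Fin N → ℕ} {g : 𝒢} {w : ℝ} (hw : 0 ≤ w)
    (h : ∀ i, lcb δ X T (g, i) ≤ ucbQuantile α δ X T g →
      lcbQuantile α δ X T g ≤ ucb δ X T (g, i) →
      confWidth (T (g, i)) (δ / ((N * Fintype.card 𝒢 : ℕ) : ℝ)) ≤ w) :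
    ucbQuantile α δ X T g ≤ lcbQuantile α δ X T g + 2 * w := by
  have hp0 : 0 < 1 - α := by linarith [hα.2]
  have hp1 : 1 - α ≤ 1 := by linarith [hα.1]
  refine (finQuantile_le_iff hN hp0 hp1 _ _).2 ?_
  refine le_trans (finQuantile_isLeast hN hp0 hp1 fun i => lcb δ X T (g, i)).1 ?_
  refine div_le_div_of_nonneg_right (Nat.cast_le.2 (Finset.card_le_card fun i hi => ?_))
    (by positivity)
  simp only [Finset.mem_filter, Finset.mem_univ, true_and] at hi ⊢
  change lcb δ X T (g, i) ≤ lcbQuantile α δ X T g at hi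
  -- An arm with LCB at most L either has UCB below L already, or is a potential quantile arm, whose
  -- interval has length at most 2w. So at least as many UCBs lie below L + 2w as LCBs below L.
  by_cases hu : lcbQuantile α δ X T g ≤ ucb δ X T (g, i)
  · have := h i (hi.trans (lcbQuantile_le_ucbQuantile hN hα T g)) hu
    rw [ucb_eq_lcb_add]
    linarith
  · linarith

lemma elimState_succ (k : ℕ) :
    elimState α δ X (k + 1) = ElimState.step α δ X (elimState α δ X k) :=
  Function.iterate_succ_apply' _ _ _

open scoped Classical in
lemma pulls_succ (k : ℕ) (j : 𝒢 × Fin N) :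
    (elimState α δ X (k + 1)).pulls j
      = (elimState α δ X k).pulls j + if j ∈ (elimState α δ X k).active then 1 else 0 := by
  rw [elimState_succ]
  rfl

lemma mem_candidates_succ {k : ℕ} {g : 𝒢} :
    g ∈ (elimState α δ X (k + 1)).candidates ↔ g ∈ (elimState α δ X k).candidates ∧
      ∀ g' ∈ (elimState α δ X k).candidates,
        lcbQuantile α δ X (elimState α δ X (k + 1)).pulls g'
          ≤ ucbQuantile α δ X (elimState α δ X (k + 1)).pulls g := by
  rw [elimState_succ]
  simp only [ElimState.step, Finset.mem_filter]

lemma mem_active_succ {k : ℕ} {j : 𝒢 × Fin N} :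
    j ∈ (elimState α δ X (k + 1)).active ↔ j.1 ∈ (elimState α δ X (k + 1)).candidates ∧
      lcb δ X (elimState α δ X (k + 1)).pulls j
        ≤ ucbQuantile α δ X (elimState α δ X (k + 1)).pulls j.1 ∧
      lcbQuantile α δ X (elimState α δ X (k + 1)).pulls j.1
        ≤ ucb δ X (elimState α δ X (k + 1)).pulls j := by
  rw [elimState_succ]
  simp only [ElimState.step, Finset.mem_filter, Finset.mem_univ, true_and]

lemma gap_succ (k : ℕ) : (elimState α δ X (k + 1)).gap =
    ((sSup (ucbQuantile α δ X (elimState α δ X (k + 1)).pulls ''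
        ((elimState α δ X (k + 1)).candidates : Set 𝒢))
      - sSup (lcbQuantile α δ X (elimState α δ X (k + 1)).pulls ''
        ((elimState α δ X (k + 1)).candidates : Set 𝒢)) : ℝ) : EReal) := by
  rw [elimState_succ]
  rfl

/-- All arms are active in the first round. At zero pulls the width is a division by zero and bounds
nothing. -/
lemma one_le_pulls_succ (k : ℕ) (j : 𝒢 × Fin N) : 1 ≤ (elimState α δ X (k + 1)).pulls j := by
  induction k with
  | zero =>
    rw [pulls_succ]
    simp [elimState, ElimState.init]
  | succ k ih =>
    rw [pulls_succ]
    omega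

/-- A candidate with the largest upper quantile survives each round, whatever the rewards. -/
lemma candidates_nonempty [Nonempty 𝒢] (hN : 0 < N) (hα : α ∈ Set.Ioo (0 : ℝ) 1) (k : ℕ) :
    (elimState α δ X k).candidates.Nonempty := by
  induction k with
  | zero => simp [elimState, ElimState.init]
  | succ k ih =>
    obtain ⟨g, hg, hmax⟩ := Finset.exists_max_image _
      (ucbQuantile α δ X (elimState α δ X (k + 1)).pulls) ih
    exact ⟨g, mem_candidates_succ.2 ⟨hg, fun g' hg' =>
      (lcbQuantile_le_ucbQuantile hN hα _ g').trans (hmax g' hg')⟩⟩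

/-- At the end of some round, all arms that are still active have been pulled at least `K`
times. -/
lemma exists_forall_active_le_pulls (K : ℕ) :
    ∃ k, ∀ j ∈ (elimState α δ X (k + 1)).active, K ≤ (elimState α δ X (k + 1)).pulls j := by
  classical
  by_contra! hcon
  -- Potential: total pulls with each arm capped at `K`. If every round leaves an active arm below
  -- `K`, the next round raises Φ by at least one, yet Φ is bounded.
  set Φ : ℕ → ℕ := fun k => ∑ j, min ((elimState α δ X k).pulls j) K with hΦ
  have hstep : ∀ k, Φ (k + 1) + 1 ≤ Φ (k + 1 + 1) := by
    intro k
    obtain ⟨j, hj, hjK⟩ := hcon k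
    refine Nat.succ_le_of_lt (Finset.sum_lt_sum (fun i _ => ?_) ⟨j, Finset.mem_univ j, ?_⟩)
    · rw [pulls_succ (k + 1)]
      omega
    · rw [pulls_succ (k + 1), if_pos hj]
      omega
  have hlow : ∀ k, k ≤ Φ (k + 1) := by
    intro k
    induction k with
    | zero => exact Nat.zero_le _
    | succ k ih => have := hstep k; omega
  have hup : ∀ k, Φ k ≤ Fintype.card (𝒢 × Fin N) * K := by
    intro k
    calc Φ k ≤ ∑ _j : 𝒢 × Fin N, K := Finset.sum_le_sum fun j _ => min_le_right _ _
      _ = Fintype.card (𝒢 × Fin N) * K := by simp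
  have h1 := hlow (Fintype.card (𝒢 × Fin N) * K + 1)
  have h2 := hup (Fintype.card (𝒢 × Fin N) * K + 1 + 1)
  omega

/-- The loop terminates on every reward table. -/
theorem exists_halted [Nonempty 𝒢] (hN : 0 < N) (hα : α ∈ Set.Ioo (0 : ℝ) 1) {Δ : ℝ}
    (hΔ : 0 < Δ) : ∃ k, (elimState α δ X k).Halted Δ := by
  -- Width below Δ / 2 suffices, since the two quantiles of a group differ by at most twice the
  -- width.
  obtain ⟨K, hK⟩ := eventually_atTop.1 ((tendsto_order.1
    (tendsto_confWidth (δ / ((N * Fintype.card 𝒢 : ℕ) : ℝ)))).2 (Δ / 2) (by positivity))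
  obtain ⟨k, hk⟩ := exists_forall_active_le_pulls (α := α) (δ := δ) (X := X) K
  refine ⟨k + 1, fun h => not_le_of_gt h.2 ?_⟩
  rw [gap_succ, EReal.coe_le_coe_iff]
  set s := elimState α δ X (k + 1) with hs
  have hne : s.candidates.Nonempty := candidates_nonempty hN hα (k + 1)
  rw [sub_le_iff_le_add]
  refine csSup_le (hne.to_set.image _) ?_
  rintro _ ⟨g, hg, rfl⟩
  have hV : ucbQuantile α δ X s.pulls g ≤ lcbQuantile α δ X s.pulls g + 2 * (Δ / 2) := by
    refine ucbQuantile_le_lcbQuantile_add hN hα (by positivity) fun i hi₁ hi₂ => ?_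
    exact (hK _ (hk (g, i) (mem_active_succ.2 ⟨hg, hi₁, hi₂⟩))).le
  have hL : lcbQuantile α δ X s.pulls g
      ≤ sSup (lcbQuantile α δ X s.pulls '' (s.candidates : Set 𝒢)) :=
    le_csSup ((Set.toFinite _).bddAbove) ⟨g, hg, rfl⟩
  linarith

/-- All empirical means stay within the confidence width of the arm means `μ`. -/
def Concentrated (δ : ℝ) (X : 𝒢 × Fin N → ℕ → ℝ) (μ : 𝒢 × Fin N → ℝ) : Prop :=
  ∀ j T, 1 ≤ T →
    |empMean (X j) T - μ j| ≤ confWidth T (δ / ((N * Fintype.card 𝒢 : ℕ) : ℝ))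

variable {μ : 𝒢 × Fin N → ℝ}

lemma lcbQuantile_le (hN : 0 < N) (hα : α ∈ Set.Ioo (0 : ℝ) 1) (hX : Concentrated δ X μ)
    {T : 𝒢 × Fin N → ℕ} (hT : ∀ j, 1 ≤ T j) (g : 𝒢) :
    lcbQuantile α δ X T g ≤ finQuantile (1 - α) fun i => μ (g, i) := by
  refine finQuantile_mono hN (by linarith [hα.2]) (by linarith [hα.1]) fun i => ?_
  have := (abs_le.1 (hX (g, i) _ (hT (g, i)))).2
  unfold lcb
  linarith

lemma le_ucbQuantile (hN : 0 < N) (hα : α ∈ Set.Ioo (0 : ℝ) 1) (hX : Concentrated δ X μ)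
    {T : 𝒢 × Fin N → ℕ} (hT : ∀ j, 1 ≤ T j) (g : 𝒢) :
    finQuantile (1 - α) (fun i => μ (g, i)) ≤ ucbQuantile α δ X T g := by
  refine finQuantile_mono hN (by linarith [hα.2]) (by linarith [hα.1]) fun i => ?_
  have := (abs_le.1 (hX (g, i) _ (hT (g, i)))).1
  unfold ucb
  linarith

/-- For every g', L(g') ≤ Q(μ_g') ≤ Q(μ_g) ≤ V(g), so the elimination test never removes g. -/
lemma mem_candidates_of_isMax (hN : 0 < N) (hα : α ∈ Set.Ioo (0 : ℝ) 1)
    (hX : Concentrated δ X μ) {g : 𝒢}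
    (hg : ∀ g', finQuantile (1 - α) (fun i => μ (g', i)) ≤ finQuantile (1 - α) fun i => μ (g, i))
    (k : ℕ) : g ∈ (elimState α δ X k).candidates := by
  induction k with
  | zero => simp [elimState, ElimState.init]
  | succ k ih =>
    have hT := one_le_pulls_succ (α := α) (δ := δ) (X := X) k
    exact mem_candidates_succ.2 ⟨ih, fun g' _ => (lcbQuantile_le hN hα hX hT g').trans
      ((hg g').trans (le_ucbQuantile hN hα hX hT g))⟩

/-- If all empirical means stay within the confidence width, then the returned group has a
`Δ`-optimal empirical quantile of the arm means. -/
theorem finiteArmBQID_correct [Nonempty 𝒢] (hN : 0 < N) (hα : α ∈ Set.Ioo (0 : ℝ) 1) {Δ : ℝ}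
    (hΔ : 0 < Δ) (hX : Concentrated δ X μ) {tie : Finset 𝒢 → 𝒢}
    (htie : ∀ S : Finset 𝒢, S.Nonempty → tie S ∈ S) :
    ∃ g, finiteArmBQID α Δ δ X tie = some g ∧ ∀ g',
      finQuantile (1 - α) (fun i => μ (g', i)) - Δ ≤ finQuantile (1 - α) fun i => μ (g, i) := by
  classical
  have hex := exists_halted (δ := δ) (X := X) hN hα hΔ
  refine ⟨_, dif_pos hex, ?_⟩
  have hspec := Nat.find_spec hex
  -- Only the failure of the loop condition at the stopping round matters, not that it is the first
  -- such round.
  generalize Nat.find hex = k at hspec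
  set s := elimState α δ X k with hs
  have hbest : (s.best α δ X).Nonempty := by
    obtain ⟨g, hg, hmax⟩ := Finset.exists_max_image _ (lcbQuantile α δ X s.pulls)
      (candidates_nonempty (δ := δ) (X := X) hN hα k)
    exact ⟨g, Finset.mem_filter.2 ⟨hg, hmax⟩⟩
  obtain ⟨hmem, hmax⟩ := Finset.mem_filter.1 (htie _ hbest)
  set g := tie (s.best α δ X)
  obtain ⟨gs, -, hgs⟩ := Finset.exists_max_image Finset.univ
    (fun g => finQuantile (1 - α) fun i => μ (g, i)) Finset.univ_nonempty
  have hgs' := mem_candidates_of_isMax hN hα hX (fun g' => hgs g' (Finset.mem_univ _)) k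
  suffices h : finQuantile (1 - α) (fun i => μ (gs, i)) - Δ
      ≤ finQuantile (1 - α) fun i => μ (g, i) from
    fun g' => by linarith [hgs g' (Finset.mem_univ _)]
  by_cases hcard : 1 < s.candidates.card
  · have hgap : s.gap ≤ Δ := not_lt.1 fun h => hspec ⟨hcard, h⟩
    -- The initial gap is infinite, so a stop caused by the gap comes after at least one round.
    obtain _ | k := k
    · exact absurd hgap (by simp [hs, elimState, ElimState.init])
    rw [hs, gap_succ, EReal.coe_le_coe_iff, ← hs] at hgap
    have hT := one_le_pulls_succ (α := α) (δ := δ) (X := X) k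
    have h1 := le_ucbQuantile hN hα hX hT gs
    have h2 := lcbQuantile_le hN hα hX hT g
    have h3 : ucbQuantile α δ X s.pulls gs
        ≤ sSup (ucbQuantile α δ X s.pulls '' (s.candidates : Set 𝒢)) :=
      le_csSup ((Set.toFinite _).bddAbove) ⟨gs, hgs', rfl⟩
    have h4 : sSup (lcbQuantile α δ X s.pulls '' (s.candidates : Set 𝒢))
        ≤ lcbQuantile α δ X s.pulls g := by
      refine csSup_le (Set.Nonempty.image _ ⟨g, hmem⟩) ?_
      rintro _ ⟨g', hg', rfl⟩
      exact hmax g' hg'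
    rw [← hs] at h1 h2
    linarith
  -- The only remaining candidate is the optimal group; this covers a loop that never runs, where
  -- the bounds carry no information.
  · rw [Finset.card_le_one.1 (not_lt.1 hcard) gs hgs' g hmem]
    linarith

end Elimination

/-! ### A maximal inequality for products of independent variables -/

section Maximal

variable {Ω : Type*} [MeasurableSpace Ω] {P : Measure Ω} [IsProbabilityMeasure P]

lemma integrable_prod_range {Y : ℕ → Ω → ℝ} (hmeas : ∀ i, Measurable (Y i))
    (hind : iIndepFun Y P) (hint : ∀ i, Integrable (Y i) P) (n : ℕ) :
    Integrable (∏ i ∈ Finset.range n, Y i) P := by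
  induction n with
  | zero => simpa using! integrable_const (1 : ℝ)
  | succ n ih =>
    rw [Finset.prod_range_succ]
    exact (hind.indepFun_prod_range_succ hmeas n).integrable_mul ih (hint n)

lemma integral_prod_range {Y : ℕ → Ω → ℝ} (hmeas : ∀ i, Measurable (Y i))
    (hind : iIndepFun Y P) (hint : ∀ i, Integrable (Y i) P) (hmean : ∀ i, ∫ ω, Y i ω ∂P = 1)
    (n : ℕ) : ∫ ω, (∏ i ∈ Finset.range n, Y i) ω ∂P = 1 := by
  induction n with
  | zero => simp
  | succ n ih =>
    rw [Finset.prod_range_succ, (hind.indepFun_prod_range_succ hmeas n).integral_mul_eq_mul_integral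
      (integrable_prod_range hmeas hind hint n).aestronglyMeasurable (hint n).aestronglyMeasurable,
      ih, hmean, one_mul]

/-- By independence the next factor has conditional expectation one. The index shift makes the n-th
product depend on Y 0, …, Y n, hence adapted to the natural filtration. -/
lemma submartingale_prod_range {Y : ℕ → Ω → ℝ} (hmeas : ∀ i, Measurable (Y i))
    (hind : iIndepFun Y P) (hint : ∀ i, Integrable (Y i) P) (hmean : ∀ i, ∫ ω, Y i ω ∂P = 1) :
    Submartingale (fun n => ∏ i ∈ Finset.range (n + 1), Y i)
      (Filtration.natural Y fun i => (hmeas i).stronglyMeasurable) P := by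
  have hsm : ∀ i, StronglyMeasurable (Y i) := fun i => (hmeas i).stronglyMeasurable
  have hadp : StronglyAdapted (Filtration.natural Y hsm)
      (fun n => ∏ i ∈ Finset.range (n + 1), Y i) := by
    intro n
    refine Finset.stronglyMeasurable_prod _ fun i hi => ?_
    exact (Filtration.stronglyAdapted_natural hsm i).mono
      ((Filtration.natural Y hsm).mono (Nat.lt_succ_iff.1 (Finset.mem_range.1 hi)))
  refine submartingale_nat hadp (fun n => integrable_prod_range hmeas hind hint _) fun n => ?_
  have h1 : P[(∏ i ∈ Finset.range (n + 1), Y i) * Y (n + 1) | Filtration.natural Y hsm n]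
      =ᵐ[P] (∏ i ∈ Finset.range (n + 1), Y i) * P[Y (n + 1) | Filtration.natural Y hsm n] := by
    refine condExp_mul_of_stronglyMeasurable_left (hadp n) ?_ (hint _)
    rw [← Finset.prod_range_succ]
    exact integrable_prod_range hmeas hind hint _
  have h2 := iIndepFun.condExp_natural_ae_eq_of_lt hsm hind (Nat.lt_succ_self n)
  rw [Finset.prod_range_succ _ (n + 1)]
  filter_upwards [h1, h2] with ω h1 h2
  rw [h1, Pi.mul_apply, h2, hmean, mul_one]

/-- **Ville's inequality** for the product martingale of independent nonnegative variables of
mean one. -/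
theorem measure_exists_le_prod {Y : ℕ → Ω → ℝ} (hmeas : ∀ i, Measurable (Y i))
    (hind : iIndepFun Y P) (hnonneg : ∀ i ω, 0 ≤ Y i ω) (hint : ∀ i, Integrable (Y i) P)
    (hmean : ∀ i, ∫ ω, Y i ω ∂P = 1) {c : ℝ} (hc : 0 < c) :
    P {ω | ∃ n, c ≤ ∏ i ∈ Finset.range (n + 1), Y i ω} ≤ ENNReal.ofReal (1 / c) := by
  have hsub := submartingale_prod_range hmeas hind hint hmean
  have hpos : (0 : ℕ → Ω → ℝ) ≤ fun n => ∏ i ∈ Finset.range (n + 1), Y i := by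
    intro n ω
    simpa only [Finset.prod_apply] using! Finset.prod_nonneg fun i _ => hnonneg i ω
  -- Doob's maximal inequality bounds each finite horizon uniformly; continuity from below gives the
  -- infinite one.
  set A : ℕ → Set Ω := fun n => {ω | ∃ k ≤ n, c ≤ ∏ i ∈ Finset.range (k + 1), Y i ω} with hA
  have hmono : Monotone A := fun m n hmn ω ⟨k, hk, h⟩ => ⟨k, hk.trans hmn, h⟩
  have hunion : {ω | ∃ n, c ≤ ∏ i ∈ Finset.range (n + 1), Y i ω} = ⋃ n, A n := by
    ext ω
    simp only [hA, Set.mem_iUnion]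
    exact ⟨fun ⟨n, h⟩ => ⟨n, n, le_rfl, h⟩, fun ⟨_, k, _, h⟩ => ⟨k, h⟩⟩
  rw [hunion, hmono.measure_iUnion]
  refine iSup_le fun n => ?_
  lift c to ℝ≥0 using hc.le
  have hmax := maximal_ineq hsub hpos (ε := c) n
  have hset : {ω | (c : ℝ) ≤ (Finset.range (n + 1)).sup'
      Finset.nonempty_range_add_one fun k => (∏ i ∈ Finset.range (k + 1), Y i) ω} = A n := by
    ext ω
    change (c : ℝ) ≤ _ ↔ ∃ k ≤ n, _
    rw [Finset.le_sup'_iff]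
    simp
  rw [hset] at hmax
  have hle : ∫ ω in A n, (∏ i ∈ Finset.range (n + 1), Y i) ω ∂P ≤ 1 := by
    refine (setIntegral_le_integral (integrable_prod_range hmeas hind hint _)
      (Eventually.of_forall (hpos n))).trans_eq (integral_prod_range hmeas hind hint hmean _)
  have hmax' : ENNReal.ofReal c * P (A n) ≤ 1 := by
    calc ENNReal.ofReal c * P (A n) = c * P (A n) := by rw [ENNReal.ofReal_coe_nnreal]
      _ ≤ _ := hmax
      _ ≤ ENNReal.ofReal 1 := ENNReal.ofReal_le_ofReal hle
      _ = 1 := ENNReal.ofReal_one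
  rw [one_div, ENNReal.ofReal_inv_of_pos hc, ← one_div]
  exact (ENNReal.le_div_iff_mul_le (Or.inl (by simpa using hc.ne')) (Or.inl (by simp))).2
    (by rwa [mul_comm])

/-- The partial sums of independent `1`-sub-Gaussian variables stay below a line. -/
theorem measure_exists_line_le_sum {Z : ℕ → Ω → ℝ} (hmeas : ∀ i, Measurable (Z i))
    (hind : iIndepFun Z P) {c : ℕ → ℝ≥0} (hc : ∀ i, c i ≤ 1)
    (hsub : ∀ i, HasSubgaussianMGF (Z i) (c i) P) (l b : ℝ) :
    P {ω | ∃ n : ℕ, b ≤ l * ∑ i ∈ Finset.range (n + 1), Z i ω - l ^ 2 / 2 * (n + 1 : ℕ)}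
      ≤ ENNReal.ofReal (Real.exp (-b)) := by
  have hpos : ∀ i, 0 < mgf (Z i) P l := fun i => mgf_pos ((hsub i).integrable_exp_mul l)
  have hle : ∀ i, mgf (Z i) P l ≤ Real.exp (l ^ 2 / 2) := fun i => by
    refine ((hsub i).mgf_le l).trans (Real.exp_le_exp.2 ?_)
    have h1 : ((c i : ℝ≥0) : ℝ) ≤ 1 := by exact_mod_cast hc i
    nlinarith [sq_nonneg l]
  -- Dividing by the exact moment generating function gives mean one; the bound exp (l² / 2) enters
  -- only afterwards, when products are compared.
  have hville := measure_exists_le_prod (P := P)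
    (Y := fun i ω => Real.exp (l * Z i ω) / mgf (Z i) P l)
    (fun i => by have := hmeas i; fun_prop)
    (hind.comp (fun i x => Real.exp (l * x) / mgf (Z i) P l) fun i => by fun_prop)
    (fun i ω => div_nonneg (Real.exp_pos _).le (hpos i).le)
    (fun i => ((hsub i).integrable_exp_mul l).div_const _)
    (fun i => by
      rw [integral_div]
      exact div_self (hpos i).ne')
    (Real.exp_pos b)
  rw [one_div, ← Real.exp_neg] at hville
  refine (measure_mono ?_).trans hville
  rintro ω ⟨n, hn⟩
  refine ⟨n, (Real.exp_le_exp.2 hn).trans ?_⟩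
  calc Real.exp (l * ∑ i ∈ Finset.range (n + 1), Z i ω - l ^ 2 / 2 * (n + 1 : ℕ))
      = ∏ i ∈ Finset.range (n + 1), Real.exp (l * Z i ω) / Real.exp (l ^ 2 / 2) := by
        rw [Finset.prod_div_distrib, ← Real.exp_sum, Finset.prod_const, Finset.card_range,
          ← Real.exp_nat_mul, ← Real.exp_sub, Finset.mul_sum]
        congr 1
        ring
    _ ≤ ∏ i ∈ Finset.range (n + 1), Real.exp (l * Z i ω) / mgf (Z i) P l := by
        refine Finset.prod_le_prod (fun i _ => by positivity) fun i _ => ?_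
        exact div_le_div_of_nonneg_left (Real.exp_pos _).le (hpos i) (hle i)

end Maximal

/-! ### A finite-time law of the iterated logarithm -/

/-- On the epoch `A ≤ √T < A (1 + v) / (1 - v)` the parabola `√(2 T y)` lies above a line of slope
`l / 2` whose height over the origin is `(1 - v²) y / l`. -/
lemma line_le_of_sqrt_le {A v y s S : ℝ} (hA : 0 < A) (hv1 : v < 1) (hy : 0 ≤ y)
    (hs1 : A ≤ s) (hs2 : s * (1 - v) ≤ A * (1 + v)) (hS : Real.sqrt (2 * y) * s ≤ S) :
    (1 - v ^ 2) * y ≤ Real.sqrt (2 * y) * (1 - v) / A * S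
      - (Real.sqrt (2 * y) * (1 - v) / A) ^ 2 / 2 * s ^ 2 := by
  set r := Real.sqrt (2 * y) with hr
  have hr0 : 0 ≤ r := Real.sqrt_nonneg _
  have hr2 : r ^ 2 = 2 * y := Real.sq_sqrt (by positivity)
  have hq : 0 ≤ r * (1 - v) / A := div_nonneg (mul_nonneg hr0 (by linarith)) hA.le
  have h1 := mul_le_mul_of_nonneg_left hS hq
  -- The slope centres the epoch: z runs over [1 - v, 1 + v], and 2z - z² - (1 - v²) = (z - (1 - v))
  -- ((1 + v) - z) ≥ 0.
  set z := s * (1 - v) / A with hz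
  have hz1 : 1 - v ≤ z := by
    rw [hz, le_div_iff₀ hA]
    nlinarith
  have hz2 : z ≤ 1 + v := by
    rw [hz, div_le_iff₀ hA]
    linarith
  have h2 : r * (1 - v) / A * (r * s) - (r * (1 - v) / A) ^ 2 / 2 * s ^ 2
      = 2 * y * z - y * z ^ 2 := by
    have : r * (1 - v) / A * (r * s) - (r * (1 - v) / A) ^ 2 / 2 * s ^ 2
      = r ^ 2 * z - r ^ 2 * z ^ 2 / 2 := by
      rw [hz]
      ring
    rw [this, hr2]
    ring
  have h3 : (1 - v ^ 2) * y ≤ 2 * y * z - y * z ^ 2 := by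
    nlinarith [mul_nonneg hy (mul_nonneg (sub_nonneg.2 hz1) (sub_nonneg.2 hz2))]
  linarith

/-- The first term of the power series of 2 artanh v. It bounds from below the logarithmic length of
an epoch. -/
lemma two_mul_le_log_div {v : ℝ} (hv0 : 0 < v) (hv1 : v < 1) :
    2 * v ≤ Real.log ((1 + v) / (1 - v)) := by
  have h := Real.hasSum_log_sub_log_of_abs_lt_one (x := v) (by rw [abs_of_pos hv0]; exact hv1)
  rw [Real.log_div (by linarith) (by linarith)]
  refine le_trans ?_ (le_hasSum h 0 fun k _ => by positivity)
  simp

/-- Comparison of `∑ (1 + h k)^(-4/3)` with the integral. -/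
lemma sum_range_rpow_le {h : ℝ} (hh : 0 < h) (n : ℕ) :
    ∑ k ∈ Finset.range n, (1 + h * k) ^ (-(4 / 3) : ℝ) ≤ 1 + 3 / h := by
  -- Telescoping against the antiderivative -(3 / h) (1 + h x)^(-1/3). With `a`, `b` the cube roots
  -- of consecutive nodes, h = b³ - a³ and each step is polynomial.
  have key : ∀ n : ℕ, ∑ k ∈ Finset.range (n + 1), (1 + h * k) ^ (-(4 / 3) : ℝ)
      ≤ 1 + 3 / h * (1 - ((1 + h * n) ^ (1 / 3 : ℝ))⁻¹) := by
    intro n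
    induction n with
    | zero => simp
    | succ n ih =>
      rw [Finset.sum_range_succ]
      set a := (1 + h * n) ^ (1 / 3 : ℝ) with ha
      set b := (1 + h * (n + 1 : ℕ)) ^ (1 / 3 : ℝ) with hb
      have hx : (0 : ℝ) < 1 + h * n := by positivity
      have hx' : (0 : ℝ) < 1 + h * (n + 1 : ℕ) := by positivity
      have ha0 : 0 < a := Real.rpow_pos_of_pos hx _
      have hb0 : 0 < b := Real.rpow_pos_of_pos hx' _
      have ha3 : a ^ 3 = 1 + h * n := by
        rw [ha, ← Real.rpow_natCast, ← Real.rpow_mul hx.le]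
        norm_num
      have hb3 : b ^ 3 = 1 + h * (n + 1 : ℕ) := by
        rw [hb, ← Real.rpow_natCast, ← Real.rpow_mul hx'.le]
        norm_num
      have hb4 : (1 + h * (n + 1 : ℕ)) ^ (-(4 / 3) : ℝ) = (b ^ 4)⁻¹ := by
        rw [hb, ← Real.rpow_natCast, ← Real.rpow_mul hx'.le, ← Real.rpow_neg hx'.le]
        norm_num
      have hd : h = b ^ 3 - a ^ 3 := by
        rw [ha3, hb3]
        push_cast
        ring
      have hab : a ≤ b := by
        refine Real.rpow_le_rpow hx.le ?_ (by norm_num)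
        push_cast
        nlinarith
      have hstep : (b ^ 4)⁻¹ ≤ 3 / h * (a⁻¹ - b⁻¹) := by
        have : 3 / h * (a⁻¹ - b⁻¹) - (b ^ 4)⁻¹
            = (3 * b ^ 3 * (b - a) - a * h) / (h * a * b ^ 4) := by
          field_simp
        have h2 : 0 ≤ 3 * b ^ 3 * (b - a) - a * h := by
          have : 3 * b ^ 3 * (b - a) - a * h
              = (b - a) * (3 * b ^ 3 - a * (b ^ 2 + a * b + a ^ 2)) := by
            rw [hd]
            ring
          rw [this]
          refine mul_nonneg (sub_nonneg.2 hab) ?_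
          have e1 : a * b ^ 2 ≤ b * b ^ 2 := by gcongr
          have e2 : a * (a * b) ≤ b * (b * b) := by gcongr
          have e3 : a * a ^ 2 ≤ b * b ^ 2 := by gcongr
          nlinarith
        have h3 : 0 ≤ 3 / h * (a⁻¹ - b⁻¹) - (b ^ 4)⁻¹ := by
          rw [this]
          positivity
        linarith
      rw [hb4]
      have e : 1 + 3 / h * (1 - b⁻¹) = 1 + 3 / h * (1 - a⁻¹) + 3 / h * (a⁻¹ - b⁻¹) := by ring
      rw [e]
      linarith
  obtain _ | n := n
  · simp only [Finset.range_zero, Finset.sum_empty]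
    positivity
  · refine (key n).trans ?_
    have : 0 ≤ 3 / h * ((1 + h * n) ^ (1 / 3 : ℝ))⁻¹ := by positivity
    linarith

/-- Shows the boundary for partial sums as a parabola √(2 T y), with y growing like (3/2) log (1 +
log T). -/
lemma mul_confWidth (n : ℕ) (η : ℝ) :
    ((n + 1 : ℕ) : ℝ) * confWidth (n + 1) η
      = Real.sqrt ((2 * (Real.log (1 / η) + 3 * Real.log (Real.log (1 / η)))
        + 3 * Real.log (1 + Real.log (n + 1 : ℕ))) * (n + 1 : ℕ)) := by
  have hT : (0 : ℝ) < (n + 1 : ℕ) := by positivity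
  have h1 : Real.log (Real.exp 1 * (n + 1 : ℕ)) = 1 + Real.log (n + 1 : ℕ) := by
    rw [Real.log_mul (Real.exp_ne_zero _) hT.ne', Real.log_exp]
  rw [confWidth, h1]
  nth_rewrite 1 [← Real.sqrt_sq hT.le]
  rw [← Real.sqrt_mul (sq_nonneg _)]
  congr 1
  field_simp
  ring

/-- The failure probability of the stitched boundary is at most half of the nominal level. -/
lemma stitching_const_le {η v : ℝ} (hη0 : 0 < η) {l x : ℝ} (hl : 2.77 ≤ l)
    (hlog : Real.log (1 / η) = l) (hx : x = l + 3 * Real.log l) (hx0 : 0 < x)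
    (hv : v = 1 / Real.sqrt (2 * x)) :
    Real.exp (-((1 - v ^ 2) * x)) * (1 + 3 / (4 * v)) ≤ η / 2 := by
  have hl0 : 0 < l := by linarith
  have hs0 : 0 < Real.sqrt (2 * x) := Real.sqrt_pos.2 (by positivity)
  -- The choice of v makes the slope loss v² x cost only a factor e^(1/2).
  have hv2 : v ^ 2 * x = 1 / 2 := by
    rw [hv, div_pow, Real.sq_sqrt (by positivity)]
    field_simp
  have hexp : Real.exp (-((1 - v ^ 2) * x)) = η / l ^ 3 * Real.exp (1 / 2) := by
    have e1 : Real.exp (-l) = η := by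
      rw [← hlog, one_div, Real.log_inv, neg_neg, Real.exp_log hη0]
    have e2 : Real.exp (-(3 * Real.log l)) = (l ^ 3)⁻¹ := by
      rw [Real.exp_neg]
      congr 1
      rw [show (3 : ℝ) * Real.log l = ((3 : ℕ) : ℝ) * Real.log l by norm_num, Real.exp_nat_mul,
        Real.exp_log hl0]
    rw [show -((1 - v ^ 2) * x) = -l + -(3 * Real.log l) + 1 / 2 by
      linear_combination -hx + hv2, Real.exp_add, Real.exp_add, e1, e2]
    ring
  have hhalf : Real.exp (1 / 2) ≤ 1.65 := by
    have : Real.exp (1 / 2) ^ 2 = Real.exp 1 := by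
      rw [← Real.exp_nat_mul]
      norm_num
    have h1 := Real.exp_one_lt_d9
    nlinarith [Real.exp_pos (1 / 2)]
  -- The tangent of log at 2 gives log l ≤ l / 2, hence 2x ≤ 5l ≤ (1.5 l)². The sum over epochs is
  -- thus O(l), which the factor l⁻³ coming from 3 log l absorbs.
  have hsq : Real.sqrt (2 * x) ≤ 1.5 * l := by
    rw [Real.sqrt_le_left (by positivity)]
    have h1 : Real.log l ≤ l / 2 := by
      have h2 := Real.log_le_sub_one_of_pos (show 0 < l / 2 by positivity)
      rw [Real.log_div hl0.ne' (by norm_num)] at h2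
      linarith [Real.log_two_lt_d9]
    nlinarith
  have hfrac : 3 / (4 * v) = 0.75 * Real.sqrt (2 * x) := by
    rw [hv]
    field_simp
    norm_num
  rw [hexp, hfrac]
  calc η / l ^ 3 * Real.exp (1 / 2) * (1 + 0.75 * Real.sqrt (2 * x))
      ≤ η / l ^ 3 * 1.65 * (1 + 0.75 * (1.5 * l)) := by gcongr
    _ = η / 2 * ((3.3 * (1 + 1.125 * l)) / l ^ 3) := by ring
    _ ≤ η / 2 * 1 := by
      gcongr
      rw [div_le_one (by positivity)]
      nlinarith [mul_nonneg (sub_nonneg.2 hl) (sub_nonneg.2 hl), mul_pos hl0 hl0]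
    _ = η / 2 := mul_one _

section LIL

variable {Ω : Type*} [MeasurableSpace Ω] {P : Measure Ω} [IsProbabilityMeasure P]

/-- With probability at least `1 - η / 2`, all partial sums of independent `1`-sub-Gaussian
variables stay below the boundary `T * U(T, η)`. -/
theorem measure_exists_mul_confWidth_lt_sum {Z : ℕ → Ω → ℝ} (hmeas : ∀ i, Measurable (Z i))
    (hind : iIndepFun Z P) {c : ℕ → ℝ≥0} (hc : ∀ i, c i ≤ 1)
    (hsub : ∀ i, HasSubgaussianMGF (Z i) (c i) P) {η : ℝ} (hη0 : 0 < η) (hη : η ≤ 1 / 16) :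
    P {ω | ∃ n : ℕ, ((n + 1 : ℕ) : ℝ) * confWidth (n + 1) η < ∑ i ∈ Finset.range (n + 1), Z i ω}
      ≤ ENNReal.ofReal (η / 2) := by
  obtain ⟨l, hlog⟩ : ∃ l, Real.log (1 / η) = l := ⟨_, rfl⟩
  -- 2.77 is just below log 16; it exceeds e, so log l ≥ 1 and x ≥ 5.
  have hl : 2.77 ≤ l := by
    have h1 : Real.log 16 ≤ l := by
      rw [← hlog]
      refine Real.log_le_log (by norm_num) ?_
      rw [le_div_iff₀ hη0]
      linarith
    have h2 : Real.log 16 = 4 * Real.log 2 := by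
      rw [show (16 : ℝ) = 2 ^ 4 by norm_num, Real.log_pow]
      norm_num
    linarith [Real.log_two_gt_d9]
  have hl0 : 0 < l := by linarith
  have hlogl : 1 ≤ Real.log l := by
    rw [Real.le_log_iff_exp_le hl0]
    linarith [Real.exp_one_lt_d9]
  obtain ⟨x, hx⟩ : ∃ x, x = l + 3 * Real.log l := ⟨_, rfl⟩
  have hx5 : 5 ≤ x := by linarith
  obtain ⟨v, hv⟩ : ∃ v, v = 1 / Real.sqrt (2 * x) := ⟨_, rfl⟩
  have hs0 : 0 < Real.sqrt (2 * x) := Real.sqrt_pos.2 (by positivity)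
  have hv0 : 0 < v := by rw [hv]; positivity
  have hv2 : v ^ 2 ≤ 1 / 9 := by
    rw [hv, div_pow, Real.sq_sqrt (by positivity), one_pow]
    exact one_div_le_one_div_of_le (by norm_num) (by linarith)
  have hv1 : v < 1 := by nlinarith
  set b := Real.log ((1 + v) / (1 - v)) with hb
  have hr0 : 0 < (1 + v) / (1 - v) := div_pos (by linarith) (by linarith)
  have hbv : 2 * v ≤ b := two_mul_le_log_div hv0 hv1
  have hb0 : 0 < b := by linarith
  set y : ℕ → ℝ := fun k => x + 3 / 2 * Real.log (1 + 4 * v * k) with hy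
  have hlognn : ∀ k : ℕ, 0 ≤ Real.log (1 + 4 * v * k) := fun k =>
    Real.log_nonneg (by have : 0 ≤ 4 * v * k := by positivity
                        linarith)
  have hy0 : ∀ k, 0 ≤ y k := fun k => by have := hlognn k; simp only [hy]; positivity
  -- Epoch endpoints for √T, in geometric progression with ratio (1 + v) / (1 - v).
  set A : ℕ → ℝ := fun k => Real.exp (k * b) with hA
  set q : ℕ → ℝ := fun k => Real.sqrt (2 * y k) * (1 - v) / A k with hq
  set E : ℕ → Set Ω := fun k => {ω | ∃ n : ℕ, (1 - v ^ 2) * y k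
    ≤ q k * ∑ i ∈ Finset.range (n + 1), Z i ω - q k ^ 2 / 2 * (n + 1 : ℕ)} with hE
  have hcover : {ω | ∃ n : ℕ, ((n + 1 : ℕ) : ℝ) * confWidth (n + 1) η
      < ∑ i ∈ Finset.range (n + 1), Z i ω} ⊆ ⋃ k, E k := by
    rintro ω ⟨n, hn⟩
    rw [mul_confWidth, hlog, ← hx] at hn
    set T : ℝ := ((n + 1 : ℕ) : ℝ) with hT
    have hT1 : 1 ≤ T := by rw [hT]; exact_mod_cast Nat.succ_le_succ (Nat.zero_le n)
    have hT0 : 0 < T := by linarith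
    have hlT := Real.log_nonneg hT1
    have hsT : Real.sqrt T = Real.exp (Real.log T / 2) := by
      rw [← Real.log_sqrt hT0.le, Real.exp_log (Real.sqrt_pos.2 hT0)]
    set k := ⌊Real.log T / (2 * b)⌋₊ with hk
    have hk1 : k * (2 * b) ≤ Real.log T :=
      (le_div_iff₀ (by positivity)).1 (Nat.floor_le (by positivity))
    have hk2 : Real.log T < (k + 1) * (2 * b) :=
      (div_lt_iff₀ (by positivity)).1 (Nat.lt_floor_add_one _)
    refine Set.mem_iUnion.2 ⟨k, n, ?_⟩
    have hline := line_le_of_sqrt_le (A := A k) (v := v) (y := y k) (s := Real.sqrt T)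
      (S := ∑ i ∈ Finset.range (n + 1), Z i ω) (Real.exp_pos _) hv1 (hy0 k) ?_ ?_ ?_
    · rwa [Real.sq_sqrt hT0.le] at hline
    · rw [hsT]
      exact Real.exp_le_exp.2 (by linarith)
    · have h1 : Real.sqrt T ≤ A k * ((1 + v) / (1 - v)) := by
        calc Real.sqrt T ≤ Real.exp (k * b + b) := by
              rw [hsT]
              exact Real.exp_le_exp.2 (by linarith)
          _ = A k * ((1 + v) / (1 - v)) := by rw [Real.exp_add, hb, Real.exp_log hr0]
      rw [← mul_div_assoc, le_div_iff₀ (by linarith)] at h1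
      exact h1
    · refine le_trans ?_ hn.le
      rw [← Real.sqrt_mul (by have := hy0 k; positivity)]
      refine Real.sqrt_le_sqrt (mul_le_mul_of_nonneg_right ?_ hT0.le)
      -- Since b ≥ 2v, the epoch index satisfies 4 v k ≤ log T, so y k is at most the y of the true
      -- boundary at T.
      have h1 : 4 * v * k ≤ Real.log T := by
        have : (k : ℝ) * (2 * (2 * v)) ≤ k * (2 * b) := by gcongr
        linarith
      have h2 : Real.log (1 + 4 * v * k) ≤ Real.log (1 + Real.log T) :=
        Real.log_le_log (by positivity) (by linarith)
      simp only [hy]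
      linarith
  have hterm : ∀ k, P (E k) ≤ ENNReal.ofReal (Real.exp (-((1 - v ^ 2) * x))
      * (1 + 4 * v * k) ^ (-(4 / 3) : ℝ)) := by
    intro k
    refine (measure_exists_line_le_sum hmeas hind hc hsub (q k) _).trans
      (ENNReal.ofReal_le_ofReal ?_)
    rw [Real.rpow_def_of_pos (by positivity), ← Real.exp_add]
    refine Real.exp_le_exp.2 ?_
    simp only [hy]
    -- As v² ≤ 1/9, the exponent (1 - v²) · 3/2 is at least 4/3, which is summable.
    nlinarith [hlognn k]
  refine (measure_mono hcover).trans ((measure_iUnion_le E).trans ?_)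
  rw [ENNReal.tsum_eq_iSup_nat]
  refine iSup_le fun n => ?_
  calc ∑ k ∈ Finset.range n, P (E k)
      ≤ ∑ k ∈ Finset.range n, ENNReal.ofReal (Real.exp (-((1 - v ^ 2) * x))
        * (1 + 4 * v * k) ^ (-(4 / 3) : ℝ)) := Finset.sum_le_sum fun k _ => hterm k
    _ = ENNReal.ofReal (Real.exp (-((1 - v ^ 2) * x))
        * ∑ k ∈ Finset.range n, (1 + 4 * v * k) ^ (-(4 / 3) : ℝ)) := by
      rw [Finset.mul_sum, ENNReal.ofReal_sum_of_nonneg fun k _ => by positivity]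
    _ ≤ ENNReal.ofReal (Real.exp (-((1 - v ^ 2) * x)) * (1 + 3 / (4 * v))) := by
      have := sum_range_rpow_le (h := 4 * v) (by positivity) n
      gcongr
    _ ≤ ENNReal.ofReal (η / 2) :=
      ENNReal.ofReal_le_ofReal (stitching_const_le hη0 hl hlog hx (by linarith) hv)

/-- With probability at least `1 - η`, all empirical means of independent `1`-sub-Gaussian
variables stay within the confidence width of their common mean. -/
theorem measure_exists_confWidth_lt_abs {W : ℕ → Ω → ℝ} {m : ℝ} (hmeas : ∀ i, Measurable (W i))
    (hind : iIndepFun W P) {c : ℕ → ℝ≥0} (hc : ∀ i, c i ≤ 1)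
    (hsub : ∀ i, HasSubgaussianMGF (fun ω => W i ω - m) (c i) P) {η : ℝ} (hη0 : 0 < η)
    (hη : η ≤ 1 / 16) :
    P {ω | ∃ n : ℕ, confWidth (n + 1) η < |empMean (fun s => W s ω) (n + 1) - m|}
      ≤ ENNReal.ofReal η := by
  have h1 := measure_exists_mul_confWidth_lt_sum (Z := fun i ω => W i ω - m)
    (fun i => (hmeas i).sub_const m) (hind.comp (fun _ x => x - m) fun _ => by fun_prop) hc hsub
    hη0 hη
  have h2 := measure_exists_mul_confWidth_lt_sum (Z := fun i ω => -(W i ω - m))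
    (fun i => ((hmeas i).sub_const m).neg)
    (hind.comp (fun _ x => -(x - m)) fun _ => by fun_prop) hc (fun i => (hsub i).neg) hη0 hη
  have hcover : {ω | ∃ n : ℕ, confWidth (n + 1) η < |empMean (fun s => W s ω) (n + 1) - m|}
      ⊆ {ω | ∃ n : ℕ, ((n + 1 : ℕ) : ℝ) * confWidth (n + 1) η
          < ∑ i ∈ Finset.range (n + 1), (W i ω - m)}
        ∪ {ω | ∃ n : ℕ, ((n + 1 : ℕ) : ℝ) * confWidth (n + 1) η
          < ∑ i ∈ Finset.range (n + 1), -(W i ω - m)} := by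
    rintro ω ⟨n, hn⟩
    have hT : (0 : ℝ) < (n + 1 : ℕ) := by positivity
    have hsum : ∑ i ∈ Finset.range (n + 1), (W i ω - m)
        = ((n + 1 : ℕ) : ℝ) * (empMean (fun s => W s ω) (n + 1) - m) := by
      rw [Finset.sum_sub_distrib, empMean, mul_sub, mul_div_cancel₀ _ hT.ne']
      simp
    rcases lt_abs.1 hn with h | h
    · exact Or.inl ⟨n, by rw [hsum]; gcongr⟩
    · refine Or.inr ⟨n, ?_⟩
      rw [Finset.sum_neg_distrib, hsum, ← mul_neg]
      gcongr
  calc _ ≤ _ := measure_mono hcover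
    _ ≤ _ := measure_union_le _ _
    _ ≤ ENNReal.ofReal (η / 2) + ENNReal.ofReal (η / 2) := add_le_add h1 h2
    _ = ENNReal.ofReal η := by
      rw [← ENNReal.ofReal_add (by positivity) (by positivity), add_halves]

end LIL

/-! ### Quantiles of a reservoir distribution -/

section Quantile

variable (ρ : Measure ℝ) {p : ℝ}

lemma quantile_set_nonempty (hp : p < 1) : {τ : ℝ | p ≤ cdf ρ τ}.Nonempty :=
  (((tendsto_order.1 (tendsto_cdf_atTop ρ)).1 p hp).mono fun _ h => h.le).exists

lemma quantile_set_bddBelow (hp : 0 < p) : BddBelow {τ : ℝ | p ≤ cdf ρ τ} := by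
  obtain ⟨a, ha⟩ := ((tendsto_order.1 (tendsto_cdf_atBot ρ)).2 p hp).exists
  refine ⟨a, fun τ hτ => le_of_not_gt fun hlt => ?_⟩
  exact absurd (le_trans (show p ≤ _ from hτ) (monotone_cdf ρ hlt.le)) (not_le.2 ha)

lemma quantile_mono (hp : 0 < p) {p' : ℝ} (hpp' : p ≤ p') (hp' : p' < 1) :
    quantile ρ p ≤ quantile ρ p' :=
  csInf_le_csInf (quantile_set_bddBelow ρ hp) (quantile_set_nonempty ρ hp')
    fun _ hτ => hpp'.trans hτ

/-- Right-continuity of the distribution function. -/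
lemma le_cdf_quantile (hp1 : p < 1) : p ≤ cdf ρ (quantile ρ p) := by
  have hright : Tendsto (cdf ρ) (𝓝[>] (quantile ρ p)) (𝓝 (cdf ρ (quantile ρ p))) :=
    ((cdf ρ).right_continuous _).mono_left (nhdsWithin_mono _ Set.Ioi_subset_Ici_self)
  refine ge_of_tendsto hright (eventually_nhdsWithin_of_forall fun τ hτ => ?_)
  obtain ⟨σ, hσ, hlt⟩ := exists_lt_of_csInf_lt (quantile_set_nonempty ρ hp1) hτ
  exact le_trans (show p ≤ _ from hσ) (monotone_cdf ρ hlt.le)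

/-- The distribution function is below p left of the quantile; continuity from below passes to the
open half-line. A possible atom at the quantile rules out the closed one. -/
lemma measureReal_Iio_quantile_le [IsProbabilityMeasure ρ] (hp0 : 0 < p) :
    ρ.real (Set.Iio (quantile ρ p)) ≤ p := by
  obtain ⟨u, hu, hlt, hlim⟩ := exists_seq_strictMono_tendsto (quantile ρ p)
  have hunion : Set.Iio (quantile ρ p) = ⋃ n, Set.Iic (u n) := by
    ext τ
    simp only [Set.mem_Iio, Set.mem_iUnion, Set.mem_Iic]
    refine ⟨fun h => ?_, fun ⟨n, h⟩ => h.trans_lt (hlt n)⟩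
    exact (((tendsto_order.1 hlim).1 τ h).mono fun _ h => h.le).exists
  have hmono : Monotone fun n => Set.Iic (u n) :=
    fun m n hmn => Set.Iic_subset_Iic.2 (hu.monotone hmn)
  have htend := tendsto_measure_iUnion_atTop (μ := ρ) hmono
  rw [← hunion] at htend
  have h := le_of_tendsto' htend (b := ENNReal.ofReal p) fun n => by
    simp only [Function.comp_apply]
    rw [← ofReal_cdf ρ]
    refine ENNReal.ofReal_le_ofReal (le_of_not_gt fun hn => ?_)
    exact not_lt.2 (csInf_le (quantile_set_bddBelow ρ hp0) hn.le) (hlt n)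
  rw [measureReal_def]
  exact ENNReal.toReal_le_of_le_ofReal hp0.le h

end Quantile

/-! ### Deviations of empirical quantiles -/

section Hoeffding

variable {Ω : Type*} [MeasurableSpace Ω] {P : Measure Ω} [IsProbabilityMeasure P]
  {N : ℕ} {Y : Fin N → Ω → ℝ} {ρ : Measure ℝ}

open scoped Classical in
/-- **Hoeffding's inequality** for the number of samples that fall into a set. -/
lemma measureReal_le_card_filter (hmeas : ∀ i, Measurable (Y i))
    (hind : iIndepFun Y P) (hlaw : ∀ i, P.map (Y i) = ρ) {A : Set ℝ} (hA : MeasurableSet A)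
    {ε : ℝ} (hε : 0 ≤ ε) :
    P.real {ω | N * (ρ.real A + ε) ≤ ((Finset.univ.filter fun i => Y i ω ∈ A).card : ℝ)}
      ≤ Real.exp (-(2 * N * ε ^ 2)) := by
  obtain rfl | hN := Nat.eq_zero_or_pos N
  · simp
  set f : ℝ → ℝ := A.indicator fun _ => 1 with hf
  have hfm : Measurable f := measurable_const.indicator hA
  have hmean : ∀ i, ∫ ω, f (Y i ω) ∂P = ρ.real A := by
    intro i
    rw [← integral_map (hmeas i).aemeasurable hfm.aestronglyMeasurable, hlaw i, hf,
      integral_indicator_const _ hA, smul_eq_mul, mul_one]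
  have hsub : ∀ i ∈ (Finset.univ : Finset (Fin N)),
      -- Hoeffding's lemma: a [0, 1]-valued variable has parameter 1/4.
      HasSubgaussianMGF (fun ω => f (Y i ω) - ρ.real A) ((‖(1 : ℝ) - 0‖₊ / 2) ^ 2) P := by
    intro i _
    rw [← hmean i]
    refine hasSubgaussianMGF_of_mem_Icc (hfm.comp (hmeas i)).aemeasurable (ae_of_all _ fun ω => ?_)
    by_cases h : Y i ω ∈ A <;> simp [hf, h]
  have hH := HasSubgaussianMGF.measure_sum_ge_le_of_iIndepFun
    (hind.comp (fun _ x => f x - ρ.real A) fun _ => by fun_prop)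
    (s := Finset.univ) hsub (ε := N * ε) (by positivity)
  have hset : {ω | N * (ρ.real A + ε) ≤ ((Finset.univ.filter fun i => Y i ω ∈ A).card : ℝ)}
      = {ω | N * ε ≤ ∑ i, (f (Y i ω) - ρ.real A)} := by
    ext ω
    have : ∑ i, f (Y i ω) = ((Finset.univ.filter fun i => Y i ω ∈ A).card : ℝ) := by
      simp [hf, Set.indicator_apply]
    simp only [Set.mem_ofPred_eq, Finset.sum_sub_distrib, this, Finset.sum_const,
      Finset.card_univ, Fintype.card_fin, nsmul_eq_mul]
    constructor <;> intro h <;> linarith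
  rw [hset]
  refine hH.trans_eq ?_
  congr 1
  have hN' : (0 : ℝ) < N := by exact_mod_cast hN
  simp only [Finset.sum_const, Finset.card_univ, Fintype.card_fin, nsmul_eq_mul, sub_zero,
    nnnorm_one]
  push_cast
  field_simp

variable [IsProbabilityMeasure ρ] {a ε : ℝ}

/-- On this event at least a N samples lie strictly below a point whose strict lower tail has mass
at most a - ε. -/
lemma measureReal_finQuantile_lt (hN : 0 < N) (hmeas : ∀ i, Measurable (Y i))
    (hind : iIndepFun Y P) (hlaw : ∀ i, P.map (Y i) = ρ) (hε : 0 ≤ ε) (h0 : 0 < a - ε)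
    (h1 : a ≤ 1) :
    P.real {ω | finQuantile a (fun i => Y i ω) < quantile ρ (a - ε)}
      ≤ Real.exp (-(2 * N * ε ^ 2)) := by
  classical
  refine (measureReal_mono ?_).trans
    (measureReal_le_card_filter hmeas hind hlaw (measurableSet_Iio (a := quantile ρ (a - ε))) hε)
  intro ω hω
  simp only [Set.mem_ofPred_eq, Set.mem_Iio] at hω ⊢
  have hN' : (0 : ℝ) < N := by exact_mod_cast hN
  have h2 := (finQuantile_isLeast hN (by linarith) h1 fun i => Y i ω).1
  rw [Set.mem_ofPred_eq, le_div_iff₀ hN'] at h2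
  have h3 : ((Finset.univ.filter fun i => Y i ω ≤ finQuantile a fun i => Y i ω).card : ℝ)
      ≤ ((Finset.univ.filter fun i => Y i ω < quantile ρ (a - ε)).card : ℝ) := by
    refine Nat.cast_le.2 (Finset.card_le_card fun i hi => ?_)
    simp only [Finset.mem_filter, Finset.mem_univ, true_and] at hi ⊢
    exact hi.trans_lt hω
  have h4 := measureReal_Iio_quantile_le ρ h0
  nlinarith

/-- On this event more than (1 - a) N samples lie above a point whose upper tail has mass at most 1
- a - ε. -/
lemma measureReal_lt_finQuantile (hN : 0 < N) (hmeas : ∀ i, Measurable (Y i))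
    (hind : iIndepFun Y P) (hlaw : ∀ i, P.map (Y i) = ρ) (hε : 0 ≤ ε) (h0 : 0 < a)
    (h1 : a + ε < 1) :
    P.real {ω | quantile ρ (a + ε) < finQuantile a fun i => Y i ω}
      ≤ Real.exp (-(2 * N * ε ^ 2)) := by
  classical
  refine (measureReal_mono ?_).trans
    (measureReal_le_card_filter hmeas hind hlaw (measurableSet_Ioi (a := quantile ρ (a + ε))) hε)
  intro ω hω
  simp only [Set.mem_ofPred_eq, Set.mem_Ioi] at hω ⊢
  have hN' : (0 : ℝ) < N := by exact_mod_cast hN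
  rw [← not_le, finQuantile_le_iff hN h0 (by linarith), not_le, div_lt_iff₀ hN'] at hω
  have h2 := le_cdf_quantile ρ h1
  rw [cdf_eq_real] at h2
  have h3 : ρ.real (Set.Ioi (quantile ρ (a + ε))) = 1 - ρ.real (Set.Iic (quantile ρ (a + ε))) := by
    rw [← Set.compl_Iic, probReal_compl_eq_one_sub measurableSet_Iic]
  have h4 : ((Finset.univ.filter fun i => Y i ω ≤ quantile ρ (a + ε)).card : ℝ)
      + ((Finset.univ.filter fun i => quantile ρ (a + ε) < Y i ω).card : ℝ) = N := by
    have := Finset.card_filter_add_card_filter_not (s := (Finset.univ : Finset (Fin N)))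
      (fun i => Y i ω ≤ quantile ρ (a + ε))
    simp only [not_le, Finset.card_univ, Fintype.card_fin] at this
    exact_mod_cast this
  rw [h3]
  nlinarith

end Hoeffding

/-! ### The random environment -/

/-- The rewards of an arm stay within the confidence width of its mean. -/
lemma armLaw_exists_confWidth_lt (ρ : Measure ℝ) [IsProbabilityMeasure ρ] (ν : Kernel ℝ ℝ)
    [IsMarkovKernel ν]
    (hν : ∀ᵐ m ∂ρ, ∃ σsq : ℝ≥0, σsq ≤ 1 ∧ HasSubgaussianMGF (fun x => x - m) σsq (ν m))
    {η : ℝ} (hη0 : 0 < η) (hη : η ≤ 1 / 16) :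
    armLaw ρ ν {z | ∃ n : ℕ, confWidth (n + 1) η < |empMean z.2 (n + 1) - z.1|}
      ≤ ENNReal.ofReal η := by
  have hD : MeasurableSet
      {z : ℝ × (ℕ → ℝ) | ∃ n : ℕ, confWidth (n + 1) η < |empMean z.2 (n + 1) - z.1|} := by
    have : {z : ℝ × (ℕ → ℝ) | ∃ n : ℕ, confWidth (n + 1) η < |empMean z.2 (n + 1) - z.1|}
        = ⋃ n : ℕ, {z | confWidth (n + 1) η < |empMean z.2 (n + 1) - z.1|} := by
      ext z
      simp
    rw [this]
    refine MeasurableSet.iUnion fun n => measurableSet_lt measurable_const ?_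
    unfold empMean
    fun_prop
  rw [armLaw, Measure.compProd_apply hD]
  -- Given the mean m, the rewards are i.i.d., so the iterated logarithm bound applies fibrewise and
  -- is then integrated over ρ.
  have hle : ∀ᵐ m ∂ρ, rewardSeq ν m (Prod.mk m ⁻¹'
      {z : ℝ × (ℕ → ℝ) | ∃ n : ℕ, confWidth (n + 1) η < |empMean z.2 (n + 1) - z.1|})
      ≤ ENNReal.ofReal η := by
    filter_upwards [hν] with m hm
    obtain ⟨σsq, hσ, hsub⟩ := hm
    refine measure_exists_confWidth_lt_abs (P := Measure.infinitePi fun _ : ℕ => ν m)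
      (W := fun i x => x i) (c := fun _ => σsq) (fun i => by fun_prop)
      (iIndepFun_infinitePi (X := fun _ x => x) fun _ => measurable_id) (fun _ => hσ)
      (fun i => ?_) hη0 hη
    refine HasSubgaussianMGF.of_map (Y := fun x : ℕ → ℝ => x i) (X := fun x => x - m)
      (measurable_pi_apply i).aemeasurable ?_
    rwa [Measure.infinitePi_map_eval]
  calc _ ≤ ∫⁻ _, ENNReal.ofReal η ∂ρ := lintegral_mono_ae hle
    _ = ENNReal.ofReal η := by simp

section Environment

variable {𝒢 Ω : Type*} [MeasurableSpace Ω] [MeasurableSpace 𝒢] {N : ℕ} {P : Measure Ω}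
  {ρ : 𝒢 → Measure ℝ} {ν : Kernel ℝ ℝ} [IsMarkovKernel ν] {M : 𝒢 × Fin N → Ω → ℝ}
  {X : 𝒢 × Fin N → ℕ → Ω → ℝ} {tie : Finset 𝒢 → Ω → 𝒢}

lemma IsEnvironment.measurable_arm (henv : IsEnvironment P ρ ν M X tie) (j : 𝒢 × Fin N) :
    Measurable fun ω => (M j ω, fun s => X j s ω) :=
  (henv.measurable_mean j).prodMk (measurable_pi_lambda _ (henv.measurable_reward j))

lemma IsEnvironment.map_mean [∀ g, IsProbabilityMeasure (ρ g)]
    (henv : IsEnvironment P ρ ν M X tie) (j : 𝒢 × Fin N) : P.map (M j) = ρ j.1 := by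
  have h : (P.map fun ω => (M j ω, fun s => X j s ω)).map Prod.fst = ρ j.1 := by
    rw [henv.arm_law j, armLaw]
    exact Measure.fst_compProd _ _
  rwa [Measure.map_map measurable_fst (henv.measurable_arm j)] at h

lemma IsEnvironment.iIndepFun_mean (henv : IsEnvironment P ρ ν M X tie) (g : 𝒢) :
    iIndepFun (fun i => M (g, i)) P :=
  (henv.arm_indep.comp (fun _ z => z.1) fun _ => measurable_fst).precomp
    (g := fun i => (g, i)) (Prod.mk_right_injective g)

/-- There are finitely many sets S, so one null set serves all of them, including the random set of
maximizers. -/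
lemma IsEnvironment.ae_tie_mem [Finite 𝒢] [MeasurableSingletonClass 𝒢]
    (henv : IsEnvironment P ρ ν M X tie) :
    ∀ᵐ ω ∂P, ∀ S : Finset 𝒢, S.Nonempty → tie S ω ∈ S := by
  refine ae_all_iff.2 fun S => ?_
  by_cases hS : S.Nonempty
  swap
  · exact ae_of_all _ fun _ h => absurd h hS
  have h : P.map (tie S) (S : Set 𝒢)ᶜ = 0 := by
    rw [henv.tie_law S hS, uniformOn_eq_zero_iff S.finite_toSet, Set.inter_compl_self]
  rw [Measure.map_apply (henv.measurable_tie S) S.measurableSet.compl] at h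
  filter_upwards [measure_eq_zero_iff_ae_notMem.1 h] with ω hω _
  simpa using hω

lemma IsEnvironment.measureReal_exists_confWidth_lt [∀ g, IsProbabilityMeasure (ρ g)]
    (henv : IsEnvironment P ρ ν M X tie) (hν : RewardAssumption ρ ν) {η : ℝ} (hη0 : 0 < η)
    (hη : η ≤ 1 / 16) (j : 𝒢 × Fin N) :
    P.real {ω | ∃ n : ℕ, confWidth (n + 1) η
      < |empMean (fun s => X j s ω) (n + 1) - M j ω|} ≤ η := by
  rw [measureReal_def]
  refine ENNReal.toReal_le_of_le_ofReal hη0.le ?_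
  refine le_trans ?_ (armLaw_exists_confWidth_lt (ρ j.1) ν ((hν j.1).mono fun _ h => h.2.2) hη0 hη)
  rw [← henv.arm_law j]
  exact Measure.le_map_apply (henv.measurable_arm j).aemeasurable _

end Environment

/-! ### The two-step algorithm -/

lemma log_le_numArms_mul {ε δ : ℝ} (hε : 0 < ε) (G : ℕ) :
    Real.log (2 * G / δ) ≤ 2 * numArms ε δ G * ε ^ 2 := by
  have h : 1 / (2 * ε ^ 2) * Real.log (2 * G / δ) ≤ (numArms ε δ G : ℝ) := Nat.le_ceil _
  rw [one_div, inv_mul_le_iff₀ (by positivity)] at h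
  linarith

lemma exp_neg_numArms_le {ε δ : ℝ} (hε : 0 < ε) (hδ : 0 < δ) {G : ℕ} (hG : 0 < G) :
    Real.exp (-(2 * numArms ε δ G * ε ^ 2)) ≤ δ / (2 * G) := by
  have hG' : (0 : ℝ) < G := by exact_mod_cast hG
  calc Real.exp (-(2 * numArms ε δ G * ε ^ 2)) ≤ Real.exp (-Real.log (2 * G / δ)) :=
        Real.exp_le_exp.2 (neg_le_neg (log_le_numArms_mul hε G))
    _ = δ / (2 * G) := by
        rw [← Real.log_inv, Real.exp_log (by positivity), inv_div]

lemma numArms_pos {ε δ : ℝ} (hε : 0 < ε) (hδ : 0 < δ) (hδ1 : δ < 1) {G : ℕ} (hG : 0 < G) :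
    0 < numArms ε δ G := by
  have hG' : (1 : ℝ) ≤ G := by exact_mod_cast hG
  refine Nat.ceil_pos.2 (mul_pos (by positivity) (Real.log_pos ?_))
  rw [lt_div_iff₀ hδ]
  linarith

/-- From log 8 ≤ 2 N ε² ≤ N / 2 and log 8 > 2. With two groups it gives n ≥ 8, hence δ / n ≤ 1/16,
the range of the iterated logarithm bound. -/
lemma four_le_numArms {ε δ : ℝ} (hε : 0 < ε) (hε2 : ε ≤ 1 / 2) (hδ : 0 < δ) (hδ2 : δ ≤ 1 / 2)
    {G : ℕ} (hG : 2 ≤ G) : 4 ≤ numArms ε δ G := by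
  have hG' : (2 : ℝ) ≤ G := by exact_mod_cast hG
  have h1 : Real.log 8 ≤ Real.log (2 * G / δ) := by
    refine Real.log_le_log (by norm_num) ?_
    rw [le_div_iff₀ hδ]
    linarith
  have h2 : Real.log 8 = 3 * Real.log 2 := by
    rw [show (8 : ℝ) = 2 ^ 3 by norm_num, Real.log_pow]
    norm_num
  have h3 := log_le_numArms_mul (δ := δ) hε G
  have h4 : ε ^ 2 ≤ 1 / 4 := by nlinarith
  have h5 : (2 : ℝ) * numArms ε δ G * ε ^ 2 ≤ 2 * numArms ε δ G * (1 / 4) := by gcongr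
  have h6 : (4 : ℝ) ≤ numArms ε δ G := by linarith [Real.log_two_gt_d9]
  exact_mod_cast h6

/-- The guarantee for any number `N` of arms per group that is large enough. -/
theorem le_measureReal_finiteArmBQID {𝒢 : Type*} [Fintype 𝒢] [Nonempty 𝒢]
    [MeasurableSpace 𝒢] [MeasurableSingletonClass 𝒢] {N : ℕ}
    {α ε Δ δ : ℝ} (hα : α ∈ Set.Ioo (0 : ℝ) 1) (hΔ : 0 < Δ)
    (hδ : 0 < δ) (hδ2 : δ ≤ 1 / 2) (hε0 : 0 < ε) (hεα : ε < α) (hεα' : ε < 1 - α)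
    (hN : 0 < N) (hN4 : 2 ≤ Fintype.card 𝒢 → 4 ≤ N)
    (hexp : Real.exp (-(2 * N * ε ^ 2)) ≤ δ / (2 * Fintype.card 𝒢))
    (ρ : 𝒢 → Measure ℝ) [∀ g, IsProbabilityMeasure (ρ g)]
    (ν : Kernel ℝ ℝ) [IsMarkovKernel ν] (hν : RewardAssumption ρ ν)
    {Ω : Type*} [MeasurableSpace Ω] (P : Measure Ω) [IsProbabilityMeasure P]
    (M : 𝒢 × Fin N → Ω → ℝ) (X : 𝒢 × Fin N → ℕ → Ω → ℝ) (tie : Finset 𝒢 → Ω → 𝒢)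
    (henv : IsEnvironment P ρ ν M X tie) :
    1 - 2 * δ ≤ P.real {ω | ∃ g : 𝒢,
      finiteArmBQID α Δ δ (fun j s => X j s ω) (fun S => tie S ω) = some g ∧
      (⨆ g' : 𝒢, quantile (ρ g') (1 - α - ε)) - Δ ≤ quantile (ρ g) (1 - α + ε)} := by
  have hcard : 0 < Fintype.card 𝒢 := Fintype.card_pos
  -- A single group needs no concentration: the answer is forced and quantiles are monotone in the
  -- level.
  obtain hsub | htwo : Fintype.card 𝒢 ≤ 1 ∨ 2 ≤ Fintype.card 𝒢 := by omega
  · have : Subsingleton 𝒢 := Fintype.card_le_one_iff_subsingleton.1 hsub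
    have huniv : {ω | ∃ g : 𝒢,
        finiteArmBQID α Δ δ (fun j s => X j s ω) (fun S => tie S ω) = some g ∧
        (⨆ g' : 𝒢, quantile (ρ g') (1 - α - ε)) - Δ ≤ quantile (ρ g) (1 - α + ε)}
          = Set.univ := by
      refine Set.eq_univ_of_forall fun ω => ⟨_, dif_pos (exists_halted hN hα hΔ), ?_⟩
      refine (sub_le_self _ hΔ.le).trans (ciSup_le fun g' => ?_)
      rw [Subsingleton.elim g' _]
      exact quantile_mono _ (by linarith) (by linarith) (by linarith)
    rw [huniv, probReal_univ]
    linarith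
  have hn0 : (0 : ℝ) < ((N * Fintype.card 𝒢 : ℕ) : ℝ) := by exact_mod_cast Nat.mul_pos hN hcard
  set η := δ / ((N * Fintype.card 𝒢 : ℕ) : ℝ) with hη
  have hη0 : 0 < η := div_pos hδ hn0
  have hη16 : η ≤ 1 / 16 := by
    have h8 : (8 : ℝ) ≤ ((N * Fintype.card 𝒢 : ℕ) : ℝ) := by
      exact_mod_cast Nat.mul_le_mul (hN4 htwo) htwo
    rw [hη, div_le_iff₀ hn0]
    linarith
  set bad₁ : 𝒢 × Fin N → Set Ω := fun j => {ω | ∃ n : ℕ, confWidth (n + 1) η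
      < |empMean (fun s => X j s ω) (n + 1) - M j ω|} with hbad₁
  set bad₂ : 𝒢 → Set Ω := fun g =>
    {ω | finQuantile (1 - α) (fun i => M (g, i) ω) < quantile (ρ g) (1 - α - ε)} with hbad₂
  set bad₃ : 𝒢 → Set Ω := fun g =>
    {ω | quantile (ρ g) (1 - α + ε) < finQuantile (1 - α) fun i => M (g, i) ω} with hbad₃
  set bad₄ : Set Ω := {ω | ¬ ∀ S : Finset 𝒢, S.Nonempty → tie S ω ∈ S} with hbad₄
  have hP₁ : P.real (⋃ j, bad₁ j) ≤ δ := by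
    calc P.real (⋃ j, bad₁ j) ≤ ∑ j, P.real (bad₁ j) := measureReal_iUnion_fintype_le _
      _ ≤ ∑ _j : 𝒢 × Fin N, η :=
        Finset.sum_le_sum fun j _ => henv.measureReal_exists_confWidth_lt hν hη0 hη16 j
      _ = δ := by
        rw [Finset.sum_const, Finset.card_univ, Fintype.card_prod, Fintype.card_fin, mul_comm,
          nsmul_eq_mul, hη, mul_div_cancel₀ _ hn0.ne']
  have hsum : ∀ bad : 𝒢 → Set Ω, (∀ g, P.real (bad g) ≤ Real.exp (-(2 * N * ε ^ 2))) →
      P.real (⋃ g, bad g) ≤ δ / 2 := by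
    intro bad hbad
    calc P.real (⋃ g, bad g) ≤ ∑ g, P.real (bad g) := measureReal_iUnion_fintype_le _
      _ ≤ ∑ _g : 𝒢, δ / (2 * Fintype.card 𝒢) :=
        Finset.sum_le_sum fun g _ => (hbad g).trans hexp
      _ = δ / 2 := by
        rw [Finset.sum_const, Finset.card_univ, nsmul_eq_mul]
        field_simp
  have hP₂ : P.real (⋃ g, bad₂ g) ≤ δ / 2 := hsum bad₂ fun g =>
    measureReal_finQuantile_lt hN (fun i => henv.measurable_mean (g, i)) (henv.iIndepFun_mean g)
      (fun i => henv.map_mean (g, i)) hε0.le (by linarith) (by linarith)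
  have hP₃ : P.real (⋃ g, bad₃ g) ≤ δ / 2 := hsum bad₃ fun g =>
    measureReal_lt_finQuantile hN (fun i => henv.measurable_mean (g, i)) (henv.iIndepFun_mean g)
      (fun i => henv.map_mean (g, i)) hε0.le (by linarith) (by linarith)
  have hP₄ : P.real bad₄ = 0 := by
    rw [measureReal_def, ae_iff.1 henv.ae_tie_mem, ENNReal.toReal_zero]
  set S := {ω | ∃ g : 𝒢,
      finiteArmBQID α Δ δ (fun j s => X j s ω) (fun S => tie S ω) = some g ∧
      (⨆ g' : 𝒢, quantile (ρ g') (1 - α - ε)) - Δ ≤ quantile (ρ g) (1 - α + ε)}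
  -- Covering the whole space and using subadditivity avoids measurability of the success event. The
  -- failure budget is δ + δ/2 + δ/2 + 0.
  have hcover : (Set.univ : Set Ω)
      ⊆ S ∪ ((⋃ j, bad₁ j) ∪ ((⋃ g, bad₂ g) ∪ ((⋃ g, bad₃ g) ∪ bad₄))) := by
    intro ω _
    by_contra hω
    simp only [Set.mem_union, Set.mem_iUnion, not_or, not_exists] at hω
    obtain ⟨hS, h₁, h₂, h₃, h₄⟩ := hω
    simp only [hbad₁, hbad₂, hbad₃, hbad₄, Set.mem_ofPred_eq, not_exists, not_lt, not_not]
      at h₁ h₂ h₃ h₄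
    have hconc : Concentrated δ (fun j s => X j s ω) (fun j => M j ω) := by
      intro j T hT
      obtain ⟨n, rfl⟩ := Nat.exists_eq_add_of_le' hT
      exact h₁ j n
    obtain ⟨g, hg, hmax⟩ := finiteArmBQID_correct hN hα hΔ hconc h₄
    refine hS ⟨g, hg, ?_⟩
    rw [sub_le_iff_le_add]
    refine ciSup_le fun g' => ?_
    linarith [h₂ g', h₃ g, hmax g']
  have h := measureReal_mono (μ := P) hcover
  rw [probReal_univ] at h
  have u₁ := measureReal_union_le (μ := P) S
    ((⋃ j, bad₁ j) ∪ ((⋃ g, bad₂ g) ∪ ((⋃ g, bad₃ g) ∪ bad₄)))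
  have u₂ := measureReal_union_le (μ := P) (⋃ j, bad₁ j) ((⋃ g, bad₂ g) ∪ ((⋃ g, bad₃ g) ∪ bad₄))
  have u₃ := measureReal_union_le (μ := P) (⋃ g, bad₂ g) ((⋃ g, bad₃ g) ∪ bad₄)
  have u₄ := measureReal_union_le (μ := P) (⋃ g, bad₃ g) bad₄
  linarith

end GroupedBandit

end

theorem mainTheorem1 {𝒢 : Type*} [Fintype 𝒢] [Nonempty 𝒢]
    [MeasurableSpace 𝒢] [MeasurableSingletonClass 𝒢]
    {α ε Δ δ : ℝ} (hα : α ∈ Set.Ioo (0 : ℝ) 1) (hΔ : Δ ∈ Set.Ioo (0 : ℝ) 1)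
    (hδ : 0 < δ) (hδε : δ < ε) (hε : ε < min α (1 - α))
    (ρ : 𝒢 → Measure ℝ) [∀ g, IsProbabilityMeasure (ρ g)]
    (ν : Kernel ℝ ℝ) [IsMarkovKernel ν] (hν : GroupedBandit.RewardAssumption ρ ν)
    {Ω : Type*} [MeasurableSpace Ω] (P : Measure Ω) [IsProbabilityMeasure P]
    (M : 𝒢 × Fin (GroupedBandit.numArms ε δ (Fintype.card 𝒢)) → Ω → ℝ)
    (X : 𝒢 × Fin (GroupedBandit.numArms ε δ (Fintype.card 𝒢)) → ℕ → Ω → ℝ)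
    (tie : Finset 𝒢 → Ω → 𝒢)
    (henv : GroupedBandit.IsEnvironment P ρ ν M X tie) :
    1 - 2 * δ ≤ P.real {ω | ∃ g : 𝒢,
      GroupedBandit.finiteArmBQID α Δ δ (fun j s => X j s ω) (fun S => tie S ω) = some g ∧
      (⨆ g' : 𝒢, GroupedBandit.quantile (ρ g') (1 - α - ε)) - Δ
        ≤ GroupedBandit.quantile (ρ g) (1 - α + ε)} := by
  obtain ⟨hεα, hεα'⟩ := lt_min_iff.1 hε
  have hε0 : 0 < ε := hδ.trans hδε
  have hcard : 0 < Fintype.card 𝒢 := Fintype.card_pos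
  exact GroupedBandit.le_measureReal_finiteArmBQID hα hΔ.1 hδ (by linarith) hε0 hεα hεα'
    (GroupedBandit.numArms_pos hε0 hδ (by linarith) hcard)
    (GroupedBandit.four_le_numArms hε0 (by linarith) hδ (by linarith))
    (GroupedBandit.exp_neg_numArms_le hε0 hδ hcard) ρ ν hν P M X tie henv
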